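/- For every $\varepsilon_0<1$ there is a constant $c>0$, depending only on $\varepsilon_0$, such that the following holds for all integers $k\ge 1$, $\ell\ge 0$, $s\ge 0$, $n\ge 0$ and every real $\varepsilon$ with $0<\varepsilon\le\varepsilon_0$ and $\varepsilon<1-\frac1k$. Consider an $s$-coin simultaneous-message protocol with $n$ users. The users hold independent samples $X_1,\dots,X_n$ from an unknown distribution $\mathbf p$ on $[k]=\{1,\dots,k\}$; all users and the server see a shared seed $U$ uniform on $\{0,1\}^s$; user $i$ also has private randomness $U_i$, where $U,U_1,\dots,U_n,(X_1,\dots,X_n)$ are jointly independent. As a function of $(U,U_i)$, user $i$ selects a randomized channel $W_i\colon[k]\to\{0,1\}^\ell$ and sends the message $Y_i\sim W_i(\cdot\mid X_i)$; conditionally on the seed, the private randomness and the samples, the messages are independent. From $U$ and $(Y_1,\dots,Y_n)$ alone the server outputs a (possibly randomized) decision in $\{\textsf{accept},\textsf{reject}\}$. The protocol is a $(k,\varepsilon)$-uniformity test if it accepts with probability greater than $\frac{11}{12}$ when $\mathbf p$ is the uniform distribution on $[k]$, and rejects with probability greater than $\frac{11}{12}$ whenever the total variation distance between $\mathbf p$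 and the uniform distribution on $[k]$ is greater than $\varepsilon$. If such a protocol is a $(k,\varepsilon)$-uniformity test, then its number of users satisfies $$n\;\ge\; c\cdot\frac{\sqrt{k}}{\varepsilon^2}\,\sqrt{\max\Big(\frac{k}{2^{\ell}},1\Big)}\,\sqrt{\max\Big(\frac{k}{2^{s+\ell}},1\Big)}.$$ -/

import Mathlib

open MeasureTheory
open scoped ENNReal

/-- Total variation distance between two distributions on `[k]`:
the supremum over events `S` of `p(S) - q(S)`. -/
noncomputable def tvDist {k : ℕ} (p q : PMF (Fin k)) : ℝ :=
  ⨆ S : Finset (Fin k), (∑ x ∈ S, (p x).toReal - ∑ x ∈ S, (q x).toReal)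

/-- The channels with `ℓ` bits of output: each input symbol is mapped to a
distribution over `{0,1}^ℓ`. -/
abbrev BitChannel (k ℓ : ℕ) : Type := Fin k → PMF (Fin ℓ → Bool)

/-- An `s`-coin simultaneous-message-passing protocol with `n` users, inputs in `[k]`, and
`ℓ` bits of communication per user. User `i` has private randomness distributed according to
`privLaw i` on an arbitrary probability space `Priv i`, and selects a channel as a function of
the shared seed `u ∈ {0,1}^s` and of this private randomness. The server sees the shared seed
and all the messages, but none of the private randomness of the users, and outputs a possibly
randomized bit: `false` for accept, `true` for reject. -/
structure SCoinProtocol (k ℓ s n : ℕ) where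
  Priv : Fin n → Type*
  [privSpace : ∀ i, MeasurableSpace (Priv i)]
  privLaw : ∀ i, Measure (Priv i)
  [privProb : ∀ i, IsProbabilityMeasure (privLaw i)]
  channel : (Fin s → Bool) → ∀ i, Priv i → BitChannel k ℓ
  measurable_channel : ∀ u i x y, Measurable fun ω => channel u i ω x y
  server : (Fin s → Bool) → (Fin n → Fin ℓ → Bool) → PMF Bool

namespace SCoinProtocol

attribute [instance] SCoinProtocol.privSpace SCoinProtocol.privProb

variable {k ℓ s n : ℕ}

/-- Probability that the users send the messages `y`, given the shared seed `u` and the samples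
`x`: the private random variables are independent of each other, of the seed and of the
samples. -/
noncomputable def messageProb (P : SCoinProtocol k ℓ s n) (u : Fin s → Bool)
    (x : Fin n → Fin k) (y : Fin n → Fin ℓ → Bool) : ℝ≥0∞ :=
  ∫⁻ ω, ∏ i, P.channel u i (ω i) (x i) (y i) ∂(Measure.pi P.privLaw)

/-- Probability that the server outputs `b` when the seed is uniform on `{0,1}^s` and,
independently, the users' samples are i.i.d. from `p`. -/
noncomputable def outputProb (P : SCoinProtocol k ℓ s n) (p : PMF (Fin k)) (b : Bool) : ℝ≥0∞ :=
  ∑ u : Fin s → Bool, ((2 : ℝ≥0∞) ^ s)⁻¹ *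
    ∑ x : Fin n → Fin k, (∏ i, p (x i)) *
      ∑ y : Fin n → Fin ℓ → Bool, P.messageProb u x y * P.server u y b

/-- The protocol, as a whole, tests identity to `q` with distance parameter `ε` and
probability of error `δ`. -/
def IsIdentityTest (P : SCoinProtocol k ℓ s n) (q : PMF (Fin k)) (ε δ : ℝ) : Prop :=
  1 - δ < (P.outputProb q false).toReal ∧
    ∀ p : PMF (Fin k), ε < tvDist p q → 1 - δ < (P.outputProb p true).toReal

/-- `(k, ε)`-uniformity test: identity testing to the uniform distribution on `[k]`, with
probability of error `1/12`. -/
def IsUniformityTest [NeZero k] (P : SCoinProtocol k ℓ s n) (ε : ℝ) : Prop :=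
  P.IsIdentityTest (PMF.uniformOfFintype (Fin k)) ε (1 / 12)

end SCoinProtocol

/-! Perturb the uniform distribution to (1 + γz)/k with z a random balanced vector. Private
randomness averages out into the channels, so for each seed u the users are described by a positive
operator A_u (`infoOp`) of norm at most n and trace at most nT, where T = min(2^ℓ, k). Ingster's
method bounds the square of the server's gain by E exp((γ²/k)⟨z, A_u z'⟩) − 1, with z' an
independent copy of z (`expect_acceptance_le`). For subgaussian z this is of order (γ²/k)²‖A_u‖²_HS
(`expect_exp_chaos_le`), and ‖A_u‖²_HS is at most norm times trace.

The law of z may depend on the protocol but not on the seed. The sum ∑_u A_u has trace at most 2^s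
nT, so off at most θk of its eigenvectors it is bounded by 2^s nT/(θk), and so is every A_u. This
produces the dependence on s (`exists_low_spectral_subspace`).

It remains to find z in that subspace with z ≥ −1 and, since ε may be close to 1, with most
coordinates near −1 (`exists_subgaussian_perturbation`). A walk in the style of Lovett and Meka does
this: small sign steps are projected to the subspace, and coordinates near −1 or 1/θ freeze. While
many coordinates are unfrozen, enough directions are free for ‖z‖² to grow in mean; since z is
bounded, freezing must occur in time O(θ⁻³). Balance permits few coordinates near 1/θ. Domains with
k < 1/θ need only one fixed alternative. -/

open scoped BigOperators

/-! ### The chi-square method for mixtures -/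

/-- Ingster's chi-square method: the acceptance functional of a mixture of product measures is
controlled by the second moment of the likelihood ratio. -/
theorem expect_prod_le_add_sqrt {ι Y Ω : Type*} [Fintype ι] [DecidableEq ι] [Fintype Y]
    [Fintype Ω] [Nonempty Ω] (q : ι → Y → ℝ) (ρ : Ω → ι → Y → ℝ)
    (hq : ∀ i y, 0 ≤ q i y) (hq1 : ∀ i, ∑ y, q i y = 1)
    (hρ1 : ∀ ω i, ∑ y, q i y * ρ ω i y = 1)
    (h : (ι → Y) → ℝ) (h0 : ∀ y, 0 ≤ h y) (h1 : ∀ y, h y ≤ 1) :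
    𝔼 ω, ∑ y : ι → Y, h y * ∏ i, (q i (y i) * ρ ω i (y i)) ≤
      (∑ y : ι → Y, h y * ∏ i, q i (y i)) +
        √((𝔼 ω, 𝔼 ω', ∏ i, ∑ y, q i y * (ρ ω i y * ρ ω' i y)) - 1) := by
  set Q : (ι → Y) → ℝ := fun y => ∏ i, q i (y i) with hQ
  set R : Ω → (ι → Y) → ℝ := fun ω y => ∏ i, ρ ω i (y i) with hR
  set D : (ι → Y) → ℝ := fun y => (𝔼 ω, R ω y) - 1 with hD
  have hQ0 : ∀ y, 0 ≤ Q y := fun y => Finset.prod_nonneg fun i _ => hq i _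
  have hQ1 : ∑ y, Q y = 1 := by
    rw [hQ, ← Fintype.prod_sum]
    simp [hq1]
  have hQR : ∀ ω, ∑ y, Q y * R ω y = 1 := by
    intro ω
    simp_rw [hQ, hR, ← Finset.prod_mul_distrib]
    rw [← Fintype.prod_sum (fun i y => q i y * ρ ω i y)]
    simp [hρ1]
  have hQRR : ∀ ω ω', ∑ y, Q y * (R ω y * R ω' y) = ∏ i, ∑ y, q i y * (ρ ω i y * ρ ω' i y) := by
    intro ω ω'
    simp_rw [hQ, hR, ← Finset.prod_mul_distrib]
    rw [← Fintype.prod_sum (fun i y => q i y * (ρ ω i y * ρ ω' i y))]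
  have hQD : ∑ y, Q y * D y ^ 2 =
      (𝔼 ω, 𝔼 ω', ∏ i, ∑ y, q i y * (ρ ω i y * ρ ω' i y)) - 1 := by
    have e1 : ∑ y, Q y * (𝔼 ω, R ω y) = 1 := by
      simp_rw [Finset.mul_expect]
      rw [← Finset.expect_sum_comm]
      simp_rw [hQR]
      exact Fintype.expect_const 1
    have e2 : ∑ y, Q y * ((𝔼 ω, R ω y) * (𝔼 ω, R ω y)) =
        𝔼 ω, 𝔼 ω', ∏ i, ∑ y, q i y * (ρ ω i y * ρ ω' i y) := by
      simp_rw [Fintype.expect_mul_expect, Finset.mul_expect]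
      rw [← Finset.expect_sum_comm]
      refine Finset.expect_congr rfl fun ω _ => ?_
      rw [← Finset.expect_sum_comm]
      exact Finset.expect_congr rfl fun ω' _ => hQRR ω ω'
    have e3 : ∀ y, Q y * D y ^ 2 = Q y * ((𝔼 ω, R ω y) * (𝔼 ω, R ω y)) -
        2 * (Q y * (𝔼 ω, R ω y)) + Q y := by
      intro y; simp only [hD]; ring
    simp_rw [e3]
    rw [Finset.sum_add_distrib, Finset.sum_sub_distrib, ← Finset.mul_sum, e1, e2, hQ1]
    ring
  have hlhs : 𝔼 ω, ∑ y : ι → Y, h y * ∏ i, (q i (y i) * ρ ω i (y i)) =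
      (∑ y, h y * Q y) + ∑ y, h y * (Q y * D y) := by
    rw [Finset.expect_sum_comm, ← Finset.sum_add_distrib]
    refine Finset.sum_congr rfl fun y _ => ?_
    simp_rw [Finset.prod_mul_distrib]
    rw [← Finset.mul_expect, ← Finset.mul_expect]
    simp only [hD, hQ, hR]; ring
  rw [hlhs, ← hQD]
  gcongr
  apply Real.le_sqrt_of_sq_le
  -- Cauchy–Schwarz in L²(Q), using that h has Q-second moment at most 1.
  have hcs := Finset.sum_mul_sq_le_sq_mul_sq Finset.univ (fun y => h y * √(Q y))
    (fun y => √(Q y) * D y)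
  have e4 : ∀ y, h y * √(Q y) * (√(Q y) * D y) = h y * (Q y * D y) := by
    intro y
    have := Real.mul_self_sqrt (hQ0 y)
    linear_combination h y * D y * this
  have e5 : ∀ y, (√(Q y) * D y) ^ 2 = Q y * D y ^ 2 := by
    intro y; rw [mul_pow, Real.sq_sqrt (hQ0 y)]
  have e6 : ∑ y, (h y * √(Q y)) ^ 2 ≤ 1 := by
    rw [← hQ1]
    refine Finset.sum_le_sum fun y _ => ?_
    rw [mul_pow, Real.sq_sqrt (hQ0 y)]
    exact mul_le_of_le_one_left (hQ0 y) (pow_le_one₀ (h0 y) (h1 y))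
  simp_rw [e4, e5] at hcs
  refine hcs.trans (mul_le_of_le_one_left ?_ e6)
  exact Finset.sum_nonneg fun y _ => mul_nonneg (hQ0 y) (sq_nonneg _)

/-- The probability that independent messages, produced by the channels `W i` from i.i.d.
samples of `p`, pass the randomized test `h`. -/
noncomputable def acceptance {ι X Y : Type*} [Fintype ι] [DecidableEq ι] [Fintype X] [Fintype Y]
    (W : ι → X → Y → ℝ) (h : (ι → Y) → ℝ) (p : X → ℝ) : ℝ :=
  ∑ y : ι → Y, h y * ∏ i, ∑ x, p x * W i x (y i)

/-- Acceptance under a mixture of perturbed uniform distributions exceeds acceptance under the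
uniform distribution by at most the decoupled chi-square fluctuation. -/
theorem expect_acceptance_le {ι X Y Ω : Type*} [Fintype ι] [DecidableEq ι] [Fintype X] [Nonempty X]
    [Fintype Y] [Fintype Ω] [Nonempty Ω] (W : ι → X → Y → ℝ) (hW : ∀ i x y, 0 ≤ W i x y)
    (hW1 : ∀ i x, ∑ y, W i x y = 1) (z : Ω → X → ℝ) (γ : ℝ) (hγ0 : 0 ≤ γ) (hγ1 : γ ≤ 1)
    (hz : ∀ ω x, -1 ≤ z ω x) (hz0 : ∀ ω, ∑ x, z ω x = 0)
    (h : (ι → Y) → ℝ) (h0 : ∀ y, 0 ≤ h y) (h1 : ∀ y, h y ≤ 1) :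
    𝔼 ω, acceptance W h (fun x => (1 + γ * z ω x) / Fintype.card X) ≤
      acceptance W h (fun _ => 1 / Fintype.card X) +
        √((𝔼 ω, 𝔼 ω', Real.exp (γ ^ 2 / Fintype.card X * ∑ i, ∑ y,
          (∑ x, z ω x * W i x y) * (∑ x, z ω' x * W i x y) / ∑ x, W i x y)) - 1) := by
  set K : ℝ := (Fintype.card X : ℝ) with hK
  have hK0 : 0 < K := by rw [hK]; exact_mod_cast Fintype.card_pos
  set w : ι → Y → ℝ := fun i y => ∑ x, W i x y with hw
  have hw0 : ∀ i y, 0 ≤ w i y := fun i y => Finset.sum_nonneg fun x _ => hW i x y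
  have hwz : ∀ i y, w i y = 0 → ∀ x, W i x y = 0 := fun i y hwy x =>
    (Finset.sum_eq_zero_iff_of_nonneg (fun x _ => hW i x y)).1 hwy x (Finset.mem_univ _)
  have hwK : ∀ i, ∑ y, w i y = K := by
    intro i; rw [hw, Finset.sum_comm]; simp [hW1, hK]
  set v : Ω → ι → Y → ℝ := fun ω i y => ∑ x, z ω x * W i x y with hv
  have hv1 : ∀ ω i, ∑ y, v ω i y = 0 := by
    intro ω i
    simp_rw [hv]; rw [Finset.sum_comm]; simp_rw [← Finset.mul_sum, hW1, mul_one]; exact hz0 ω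
  -- An output of weight zero contributes nothing: there v / w is 0 / 0 = 0 and the likelihood ratio
  -- takes the value 1.
  have hvw : ∀ ω i y, w i y = 0 → v ω i y = 0 := by
    intro ω i y hwy; simp [hv, hwz i y hwy]
  set q : ι → Y → ℝ := fun i y => w i y / K with hq
  set ρ : Ω → ι → Y → ℝ := fun ω i y => 1 + γ * (v ω i y / w i y) with hρ
  have hwv : ∀ ω i y, w i y * (v ω i y / w i y) = v ω i y := by
    intro ω i y
    by_cases hwy : w i y = 0
    · simp [hwy, hvw ω i y hwy]
    · field_simp
  have hqρ : ∀ ω i y, q i y * ρ ω i y = ∑ x, (1 + γ * z ω x) / K * W i x y := by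
    intro ω i y
    have e : ∑ x, (1 + γ * z ω x) / K * W i x y = (w i y + γ * v ω i y) / K := by
      simp only [hw, hv, Finset.mul_sum]
      rw [← Finset.sum_add_distrib, Finset.sum_div]
      exact Finset.sum_congr rfl fun x _ => by ring
    rw [e, hq, hρ]
    have := hwv ω i y
    field_simp
    linear_combination γ * this
  have hq0 : ∀ i y, q i y = ∑ x, 1 / K * W i x y := by
    intro i y; simp only [hq, hw]; rw [← Finset.mul_sum]; ring
  have hρ0 : ∀ ω i y, 0 ≤ ρ ω i y := by
    intro ω i y
    have : -w i y ≤ v ω i y := by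
      simp only [hw, hv]; rw [← Finset.sum_neg_distrib]
      exact Finset.sum_le_sum fun x _ => by nlinarith [hz ω x, hW i x y]
    have h2 : -1 ≤ v ω i y / w i y := by
      rcases (hw0 i y).eq_or_lt with hwy | hwy
      · rw [← hwy]; simp
      · rw [le_div_iff₀ hwy]; linarith
    simp only [hρ]; nlinarith
  have key := expect_prod_le_add_sqrt q ρ (fun i y => div_nonneg (hw0 i y) hK0.le)
    (fun i => by simp only [hq]; rw [← Finset.sum_div, hwK, div_self hK0.ne'])
    (fun ω i => by
      have : ∀ y, q i y * ρ ω i y = w i y / K + γ / K * v ω i y := fun y => by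
        simp only [hq, hρ]
        have := hwv ω i y
        field_simp
        linear_combination γ * this
      simp_rw [this]
      rw [Finset.sum_add_distrib, ← Finset.mul_sum, hv1, ← Finset.sum_div, hwK,
        div_self hK0.ne']; simp) h h0 h1
  simp_rw [hqρ] at key
  simp_rw [hq0] at key
  simp only [acceptance]
  convert key.trans ?_ using 1
  gcongr with ω _ ω' _
  -- Each factor is 1 + x ≤ exp x: the terms linear in γ cancel because z is balanced. Comparing
  -- products needs nonnegative factors, hence `hρ0`.
  rw [Finset.mul_sum, Real.exp_sum]
  refine Finset.prod_le_prod (fun i _ => ?_) fun i _ => ?_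
  · refine Finset.sum_nonneg fun y _ => mul_nonneg ?_ (mul_nonneg (hρ0 _ _ _) (hρ0 _ _ _))
    rw [← hq0]; exact div_nonneg (hw0 i y) hK0.le
  · have : ∀ y, (∑ x, 1 / K * W i x y) * (ρ ω i y * ρ ω' i y) = w i y / K + γ / K * v ω i y +
        γ / K * v ω' i y + γ ^ 2 / K * (v ω i y * v ω' i y / w i y) := fun y => by
      rw [← hq0]
      simp only [hq, hρ]
      have e1 := hwv ω i y
      have e2 := hwv ω' i y
      have e3 : w i y * (v ω i y / w i y) * (v ω' i y / w i y) = v ω i y * v ω' i y / w i y := by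
        rw [e1]; ring
      linear_combination γ / K * e1 + γ / K * e2 + γ ^ 2 / K * e3
    simp_rw [this]
    rw [Finset.sum_add_distrib, Finset.sum_add_distrib, Finset.sum_add_distrib, ← Finset.mul_sum,
      ← Finset.mul_sum, ← Finset.mul_sum, hv1, hv1, ← Finset.sum_div, hwK, div_self hK0.ne']
    have := Real.add_one_le_exp (γ ^ 2 / K * ∑ y, v ω i y * v ω' i y / w i y)
    linarith

/-! ### Exponential moments of subgaussian quadratic forms -/

/-- A subgaussian variable with variance proxy `σ²` satisfies `E exp (h X²) ≤ 1 + 2 h σ²`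
as long as `h σ² ≤ 1/4`. -/
theorem expect_exp_sq_le {Ω : Type*} [Fintype Ω] [Nonempty Ω] (X : Ω → ℝ) (v h : ℝ)
    (hv : 0 ≤ v) (hh : 0 ≤ h) (hX : ∀ s : ℝ, 𝔼 ω, Real.exp (s * X ω) ≤ Real.exp (s ^ 2 * v / 2))
    (hhv : h * v ≤ 1 / 4) :
    𝔼 ω, Real.exp (h * X ω ^ 2) ≤ 1 + 2 * (h * v) := by
  -- Gaussian linearisation: exp(hx²) is the mean of exp(√(2h) g x) over a standard normal g, so the
  -- subgaussian bound applies under the integral.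
  have gauss : ∀ x : ℝ, ∫ g : ℝ, Real.exp (-(1 / 2) * g ^ 2) * Real.exp (√(2 * h) * g * x) =
      √(2 * Real.pi) * Real.exp (h * x ^ 2) := by
    intro x
    have e : ∀ g : ℝ, Real.exp (-(1 / 2) * g ^ 2) * Real.exp (√(2 * h) * g * x) =
        Real.exp (h * x ^ 2) * Real.exp (-(1 / 2) * (g - √(2 * h) * x) ^ 2) := by
      intro g
      rw [← Real.exp_add, ← Real.exp_add]
      congr 1
      have := Real.sq_sqrt (show 0 ≤ 2 * h by positivity)
      linear_combination (x ^ 2 / 2) * this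
    simp_rw [e]
    rw [integral_const_mul, integral_sub_right_eq_self (fun g : ℝ => Real.exp (-(1 / 2) * g ^ 2)),
      integral_gaussian]
    rw [mul_comm]; congr 2; ring
  have gint : ∀ x : ℝ, Integrable
      (fun g : ℝ => Real.exp (-(1 / 2) * g ^ 2) * Real.exp (√(2 * h) * g * x)) := by
    intro x
    -- A non-integrable function would have integral 0, against the positive value in `gauss`.
    by_contra hn
    have := gauss x
    rw [integral_undef hn] at this
    have : 0 < √(2 * Real.pi) * Real.exp (h * x ^ 2) := by positivity
    linarith
  have hpos : (0 : ℝ) < 1 - 2 * (h * v) := by linarith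
  have hb : (0 : ℝ) < 1 / 2 - h * v := by linarith
  have key : √(2 * Real.pi) * 𝔼 ω, Real.exp (h * X ω ^ 2) ≤ √(Real.pi / (1 / 2 - h * v)) := by
    rw [Finset.mul_expect]
    simp_rw [← gauss]
    rw [← integral_gaussian, Fintype.expect_eq_sum_div_card, ← integral_finsetSum _
      (fun ω _ => gint (X ω)), ← integral_div]
    refine integral_mono ?_ (integrable_exp_neg_mul_sq hb) ?_
    · exact (integrable_finsetSum _ fun ω _ => gint (X ω)).div_const _
    intro g
    have h1 := hX (√(2 * h) * g)
    rw [Fintype.expect_eq_sum_div_card] at h1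
    simp only
    rw [← Finset.mul_sum, mul_div_assoc]
    calc _ ≤ Real.exp (-(1 / 2) * g ^ 2) * Real.exp ((√(2 * h) * g) ^ 2 * v / 2) := by gcongr
      _ = _ := by
        rw [← Real.exp_add]; congr 1
        have := Real.sq_sqrt (show 0 ≤ 2 * h by positivity)
        linear_combination (g ^ 2 * v / 2) * this
  have e : √(Real.pi / (1 / 2 - h * v)) = √(2 * Real.pi) * √(1 / (1 - 2 * (h * v))) := by
    rw [← Real.sqrt_mul (by positivity)]
    congr 1; field_simp
  rw [e] at key
  refine (le_of_mul_le_mul_left key (by positivity)).trans ?_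
  apply Real.sqrt_le_iff.2
  have : 0 ≤ h * v := by positivity
  refine ⟨by linarith, ?_⟩
  rw [div_le_iff₀ hpos]
  -- With y = 2hv ≤ 1/2, (1 + y)²(1 − y) = 1 + y(1 − y − y²) ≥ 1.
  have h2 : 0 ≤ 1 - 2 * (h * v) - (2 * (h * v)) ^ 2 := by nlinarith
  nlinarith [mul_nonneg this h2]

/-- Exponential moments of a quadratic form `∑ j, ⟪b j, z⟫²` of a subgaussian vector `z`. -/
theorem expect_exp_sum_sq_le {Ω J V : Type*} [Fintype Ω] [Nonempty Ω] [Fintype J]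
    [NormedAddCommGroup V] [InnerProductSpace ℝ V] (z : Ω → V) (q : V → ℝ) (hq : ∀ v, 0 ≤ q v)
    (hq2 : ∀ (s : ℝ) v, q (s • v) = s ^ 2 * q v)
    (hz : ∀ v, 𝔼 ω, Real.exp (inner ℝ v (z ω)) ≤ Real.exp (q v / 2))
    (b : J → V) (a S : ℝ) (ha : 0 ≤ a) (hS : ∑ j, q (b j) < S) (haS : a * S ≤ 1 / 4) :
    𝔼 ω, Real.exp (a * ∑ j, inner ℝ (b j) (z ω) ^ 2) ≤ 1 + 2 * (a * S) := by
  have hS0 : 0 < S := (Finset.sum_nonneg fun j _ => hq (b j)).trans_lt hS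
  rcases isEmpty_or_nonempty J with hJ | hJ
  · simp; positivity
  -- The slack in `hS` is spread evenly, so that the Jensen weights r j / S are positive even where
  -- q (b j) = 0.
  set c : ℝ := (S - ∑ j, q (b j)) / Fintype.card J with hc
  have hJ0 : (0 : ℝ) < Fintype.card J := by exact_mod_cast Fintype.card_pos
  have hc0 : 0 < c := div_pos (by linarith) hJ0
  set r : J → ℝ := fun j => q (b j) + c with hr
  have hr0 : ∀ j, 0 < r j := fun j => add_pos_of_nonneg_of_pos (hq _) hc0
  have hrS : ∑ j, r j = S := by
    simp only [hr, Finset.sum_add_distrib, Finset.sum_const, Finset.card_univ, nsmul_eq_mul, hc]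
    field_simp; ring
  have hw1 : ∑ j, r j / S = 1 := by rw [← Finset.sum_div, hrS, div_self hS0.ne']
  have jensen : ∀ ω, Real.exp (a * ∑ j, inner ℝ (b j) (z ω) ^ 2) ≤
      ∑ j, r j / S * Real.exp (a * S / r j * inner ℝ (b j) (z ω) ^ 2) := by
    intro ω
    have := convexOn_exp.map_sum_le (t := Finset.univ) (w := fun j => r j / S)
      (p := fun j => a * S / r j * inner ℝ (b j) (z ω) ^ 2)
      (fun j _ => (div_pos (hr0 j) hS0).le) hw1 (fun _ _ => Set.mem_univ _)
    simp only [smul_eq_mul] at this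
    refine le_trans (le_of_eq ?_) this
    congr 1
    rw [Finset.mul_sum]
    refine Finset.sum_congr rfl fun j _ => ?_
    have := hr0 j
    field_simp
  have hj : ∀ j, 𝔼 ω, Real.exp (a * S / r j * inner ℝ (b j) (z ω) ^ 2) ≤ 1 + 2 * (a * S) := by
    intro j
    have hrj := hr0 j
    have e : a * S / r j * r j = a * S := by field_simp
    have := expect_exp_sq_le (fun ω => inner ℝ (b j) (z ω)) (r j) (a * S / r j) hrj.le
      (by positivity) (fun s => ?_) (by rw [e]; exact haS)
    · rwa [e] at this
    · have h1 := hz (s • b j)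
      simp_rw [real_inner_smul_left, hq2] at h1
      refine h1.trans (Real.exp_le_exp.2 ?_)
      have : q (b j) ≤ r j := by simp only [hr]; linarith
      gcongr
  calc _ ≤ 𝔼 ω, ∑ j, r j / S * Real.exp (a * S / r j * inner ℝ (b j) (z ω) ^ 2) :=
        Finset.expect_le_expect fun ω _ => jensen ω
    _ = ∑ j, r j / S * 𝔼 ω, Real.exp (a * S / r j * inner ℝ (b j) (z ω) ^ 2) := by
        rw [Finset.expect_sum_comm]; simp_rw [Finset.mul_expect]
    _ ≤ ∑ j, r j / S * (1 + 2 * (a * S)) := by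
        refine Finset.sum_le_sum fun j _ => mul_le_mul_of_nonneg_left (hj j) ?_
        exact (div_pos (hr0 j) hS0).le
    _ = _ := by rw [← Finset.sum_mul, hw1, one_mul]

/-- Exponential moments of the decoupled chaos `⟪z, A z'⟫` for independent copies `z, z'` of a
vector that is subgaussian with respect to the quadratic form `t * ∑ l, ⟪f l, v⟫²`. -/
theorem expect_exp_chaos_le {Ω J V : Type*} [Fintype Ω] [Nonempty Ω] [Fintype J]
    [NormedAddCommGroup V] [InnerProductSpace ℝ V] (z : Ω → V) (f : J → V) (t : ℝ) (ht : 0 ≤ t)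
    (hz : ∀ v, 𝔼 ω, Real.exp (inner ℝ v (z ω)) ≤
      Real.exp (t * (∑ l, inner ℝ (f l) v ^ 2) / 2))
    (A : V →ₗ[ℝ] V) (hA : A.IsSymmetric) (τ S : ℝ)
    (hS : ∑ j, ∑ l, inner ℝ (f l) (A (f j)) ^ 2 < S) (htS : t ^ 2 * τ ^ 2 * S ≤ 1 / 2) :
    𝔼 ω, 𝔼 ω', Real.exp (τ * inner ℝ (z ω) (A (z ω'))) ≤ 1 + t ^ 2 * τ ^ 2 * S := by
  -- Averaging over z' alone leaves a quadratic form in z.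
  have h1 : ∀ ω, 𝔼 ω', Real.exp (τ * inner ℝ (z ω) (A (z ω'))) ≤
      Real.exp (t * τ ^ 2 / 2 * ∑ l, inner ℝ (A (f l)) (z ω) ^ 2) := by
    intro ω
    have := hz (τ • A (z ω))
    simp_rw [real_inner_smul_left, real_inner_smul_right] at this
    have e1 : ∀ ω', inner ℝ (A (z ω)) (z ω') = inner ℝ (z ω) (A (z ω')) := fun ω' => hA _ _
    have e2 : ∀ l, inner ℝ (f l) (A (z ω)) = inner ℝ (A (f l)) (z ω) := fun l => (hA _ _).symm
    simp_rw [e1, e2] at this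
    refine this.trans (le_of_eq ?_)
    congr 1
    simp_rw [mul_pow]
    rw [← Finset.mul_sum]; ring
  refine (Finset.expect_le_expect fun ω _ => h1 ω).trans ?_
  rcases ht.eq_or_lt with rfl | ht
  · simp
  have := expect_exp_sum_sq_le z (fun v => t * ∑ l, inner ℝ (f l) v ^ 2)
    (fun v => mul_nonneg ht.le (Finset.sum_nonneg fun _ _ => sq_nonneg _))
    (fun s v => by
      simp_rw [real_inner_smul_right, mul_pow]
      rw [← Finset.mul_sum]; ring) hz (fun l => A (f l)) (t * τ ^ 2 / 2) (t * S) (by positivity)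
    (by rw [← Finset.mul_sum]; gcongr) (by linarith)
  refine this.trans (le_of_eq ?_)
  ring

/-! ### Random signs -/

/-- The vector of signs encoded by `ξ`. -/
noncomputable def signVec {ι : Type*} (ξ : ι → Bool) : EuclideanSpace ℝ ι :=
  WithLp.toLp 2 fun x => if ξ x then 1 else -1

theorem signVec_apply {ι : Type*} (ξ : ι → Bool) (x : ι) :
    signVec ξ x = if ξ x then 1 else -1 := rfl

section Flip

variable {ι : Type*} [DecidableEq ι]

/-- Flipping the sign at one coordinate. -/
def flipAt (x : ι) : (ι → Bool) ≃ (ι → Bool) :=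
  Equiv.piCongrRight fun y => if y = x then Equiv.boolNot else Equiv.refl Bool

theorem signVec_flipAt_self (x : ι) (ξ : ι → Bool) :
    signVec (flipAt x ξ) x = -signVec ξ x := by
  rw [signVec_apply, signVec_apply]
  cases h : ξ x <;> simp [flipAt, h, Equiv.boolNot]

theorem signVec_flipAt_of_ne {x y : ι} (hxy : y ≠ x) (ξ : ι → Bool) :
    signVec (flipAt x ξ) y = signVec ξ y := by
  rw [signVec_apply, signVec_apply]
  simp [flipAt, hxy]

end Flip

section Rademacher

variable {ι : Type*} [Fintype ι]

theorem norm_signVec_sq (ξ : ι → Bool) : ‖signVec ξ‖ ^ 2 = Fintype.card ι := by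
  rw [EuclideanSpace.norm_sq_eq]
  have : ∀ x, ‖signVec ξ x‖ ^ 2 = (1 : ℝ) := fun x => by rw [signVec_apply]; split_ifs <;> simp
  simp_rw [this]
  simp

variable [DecidableEq ι]

/-- The coordinates factor, and cosh a ≤ exp(a²/2). -/
theorem expect_exp_inner_signVec_le (v : EuclideanSpace ℝ ι) :
    𝔼 ξ : ι → Bool, Real.exp (inner ℝ v (signVec ξ)) ≤ Real.exp (‖v‖ ^ 2 / 2) := by
  have e : ∀ ξ : ι → Bool, Real.exp (inner ℝ v (signVec ξ)) =
      ∏ x, Real.exp (if ξ x then v x else -v x) := by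
    intro ξ
    rw [← Real.exp_sum, PiLp.inner_apply]
    congr 1
    refine Finset.sum_congr rfl fun x _ => ?_
    rw [signVec_apply]; split_ifs <;> simp
  simp_rw [e]
  rw [Fintype.expect_eq_sum_div_card,
    ← Fintype.prod_sum (fun x (c : Bool) => Real.exp (if c then v x else -v x)),
    div_le_iff₀ (by positivity)]
  have h2 : ∀ x, ∑ c : Bool, Real.exp (if c then v x else -v x) = 2 * Real.cosh (v x) := by
    intro x; rw [Fintype.sum_bool, Real.cosh_eq]; simp; ring
  simp_rw [h2]
  rw [Finset.prod_mul_distrib, Finset.prod_const, Fintype.card_fun, Fintype.card_bool,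
    Finset.card_univ, mul_comm]
  push_cast
  gcongr
  rw [EuclideanSpace.norm_sq_eq, Finset.sum_div, Real.exp_sum]
  refine Finset.prod_le_prod (fun x _ => (Real.cosh_pos _).le) fun x _ => ?_
  simpa using Real.cosh_le_exp_half_sq (v x)

theorem expect_signVec (x : ι) : 𝔼 ξ : ι → Bool, signVec ξ x = 0 := by
  have h := Fintype.expect_equiv (flipAt x) (fun ξ : ι → Bool => -signVec ξ x)
    (fun ξ => signVec ξ x) (fun ξ => (signVec_flipAt_self x ξ).symm)
  rw [Finset.expect_neg_distrib] at h
  linarith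

theorem expect_signVec_mul (x y : ι) :
    𝔼 ξ : ι → Bool, signVec ξ x * signVec ξ y = if x = y then 1 else 0 := by
  split_ifs with hxy
  · subst hxy
    have : ∀ ξ : ι → Bool, signVec ξ x * signVec ξ x = 1 := fun ξ => by
      rw [signVec_apply]; split_ifs <;> simp
    simp_rw [this]
    exact Fintype.expect_const 1
  · have h := Fintype.expect_equiv (flipAt x) (fun ξ : ι → Bool => -(signVec ξ x * signVec ξ y))
      (fun ξ => signVec ξ x * signVec ξ y) (fun ξ => by
        rw [signVec_flipAt_self, signVec_flipAt_of_ne (Ne.symm hxy)]; ring)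
    rw [Finset.expect_neg_distrib] at h
    linarith

theorem expect_inner_signVec (v : EuclideanSpace ℝ ι) :
    𝔼 ξ : ι → Bool, inner ℝ v (signVec ξ) = 0 := by
  simp_rw [PiLp.inner_apply]
  rw [Finset.expect_sum_comm]
  refine Finset.sum_eq_zero fun x _ => ?_
  have : ∀ ξ : ι → Bool, inner ℝ (v x) (signVec ξ x) = v x * signVec ξ x := fun ξ => by
    simp [mul_comm]
  simp_rw [this]
  rw [← Finset.mul_expect, expect_signVec, mul_zero]

theorem expect_inner_signVec_sq (v : EuclideanSpace ℝ ι) :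
    𝔼 ξ : ι → Bool, inner ℝ v (signVec ξ) ^ 2 = ‖v‖ ^ 2 := by
  have e : ∀ ξ : ι → Bool, inner ℝ v (signVec ξ) ^ 2 =
      ∑ x, ∑ y, (v x * v y) * (signVec ξ x * signVec ξ y) := fun ξ => by
    rw [PiLp.inner_apply, sq, Finset.sum_mul_sum]
    refine Finset.sum_congr rfl fun x _ => Finset.sum_congr rfl fun y _ => ?_
    simp; ring
  simp_rw [e]
  rw [Finset.expect_sum_comm, EuclideanSpace.norm_sq_eq]
  refine Finset.sum_congr rfl fun x _ => ?_
  rw [Finset.expect_sum_comm]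
  simp_rw [← Finset.mul_expect, expect_signVec_mul]
  simp [sq]

/-- Random signs are isotropic, so the mean is the trace of the projection. -/
theorem expect_norm_starProjection_signVec_sq (V : Submodule ℝ (EuclideanSpace ℝ ι)) :
    𝔼 ξ : ι → Bool, ‖V.starProjection (signVec ξ)‖ ^ 2 = Module.finrank ℝ V := by
  set w := stdOrthonormalBasis ℝ V
  have e : ∀ u : EuclideanSpace ℝ ι,
      ‖V.starProjection u‖ ^ 2 = ∑ j, inner ℝ (w j : EuclideanSpace ℝ ι) u ^ 2 := fun u => by
    have h := w.sum_sq_inner_right (V.orthogonalProjectionOnto u)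
    rw [Submodule.starProjection_apply, Submodule.norm_coe, ← h]
    refine Finset.sum_congr rfl fun j _ => ?_
    rw [Submodule.inner_orthogonalProjectionOnto_eq_of_mem_left]
  simp_rw [e]
  rw [Finset.expect_sum_comm]
  rw [Finset.sum_congr rfl fun j _ => expect_inner_signVec_sq (w j : EuclideanSpace ℝ ι)]
  have : ∀ j, ‖(w j : EuclideanSpace ℝ ι)‖ ^ 2 = 1 := fun j => by
    rw [Submodule.norm_coe, w.orthonormal.1 j, one_pow]
  simp [this]

end Rademacher

/-! ### The random walk with freezing coordinates -/

section Walk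

variable {ι : Type} [Fintype ι]

open Classical in
/-- The coordinates of `z` that are within `η` of the boundary of `[-1, B]`. -/
noncomputable def frozen (B η : ℝ) (z : EuclideanSpace ℝ ι) : Finset ι :=
  {x | z x < -1 + η ∨ B - η < z x}

theorem mem_frozen {B η : ℝ} {z : EuclideanSpace ℝ ι} {x : ι} :
    x ∈ frozen B η z ↔ z x < -1 + η ∨ B - η < z x := by simp [frozen]

variable [DecidableEq ι]

/-- The directions in which the walk may still move: balanced, zero at the frozen coordinates,
and within the span of the basis vectors indexed by `L`. -/
noncomputable def freeSpace (b : OrthonormalBasis ι ℝ (EuclideanSpace ℝ ι)) (L F : Finset ι) :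
    Submodule ℝ (EuclideanSpace ℝ ι) :=
  (Submodule.span ℝ (insert (WithLp.toLp 2 fun _ => 1)
    (Lᶜ.image b ∪ F.image fun x => EuclideanSpace.single x (1 : ℝ)) :
      Finset (EuclideanSpace ℝ ι)))ᗮ

variable (b : OrthonormalBasis ι ℝ (EuclideanSpace ℝ ι)) (L F : Finset ι)

/-- Count constraints: one for balance, one per discarded basis vector, one per frozen coordinate.
-/
theorem card_le_finrank_freeSpace :
    Fintype.card ι ≤ Module.finrank ℝ (freeSpace b L F) + (1 + Lᶜ.card + F.card) := by
  set S : Finset (EuclideanSpace ℝ ι) := insert (WithLp.toLp 2 fun _ => 1)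
    (Lᶜ.image b ∪ F.image fun x => EuclideanSpace.single x (1 : ℝ)) with hS
  have h1 := Submodule.finrank_add_finrank_orthogonal
    (Submodule.span ℝ (S : Set (EuclideanSpace ℝ ι)))
  rw [finrank_euclideanSpace] at h1
  have h2 := finrank_span_finset_le_card (R := ℝ) S
  have h3 : S.card ≤ (Lᶜ.card + F.card) + 1 := by
    refine (Finset.card_insert_le _ _).trans (Nat.succ_le_succ ?_)
    exact (Finset.card_union_le _ _).trans
      (add_le_add Finset.card_image_le Finset.card_image_le)
  have h4 : freeSpace b L F = (Submodule.span ℝ (S : Set (EuclideanSpace ℝ ι)))ᗮ := rfl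
  rw [h4]
  unfold Set.finrank at h2
  omega

variable {b L F}

theorem inner_eq_zero_of_mem_freeSpace {v : EuclideanSpace ℝ ι} (hv : v ∈ freeSpace b L F)
    {u : EuclideanSpace ℝ ι}
    (hu : u ∈ insert (WithLp.toLp 2 fun _ => 1)
      (Lᶜ.image b ∪ F.image fun x => EuclideanSpace.single x (1 : ℝ))) : inner ℝ u v = 0 :=
  (Submodule.mem_orthogonal _ _).1 hv u (Submodule.subset_span hu)

theorem sum_eq_zero_of_mem_freeSpace {v : EuclideanSpace ℝ ι} (hv : v ∈ freeSpace b L F) : ∑ x, v x = 0 := by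
  have := inner_eq_zero_of_mem_freeSpace hv (Finset.mem_insert_self _ _)
  rw [PiLp.inner_apply] at this
  simpa using this

theorem apply_eq_zero_of_mem_freeSpace {v : EuclideanSpace ℝ ι} (hv : v ∈ freeSpace b L F)
    {x : ι} (hx : x ∈ F) : v x = 0 := by
  have := inner_eq_zero_of_mem_freeSpace hv (Finset.mem_insert_of_mem
    (Finset.mem_union_right _ (Finset.mem_image_of_mem _ hx)))
  simpa [EuclideanSpace.inner_single_left] using this

theorem inner_basis_eq_zero_of_mem_freeSpace {v : EuclideanSpace ℝ ι} (hv : v ∈ freeSpace b L F)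
    {j : ι} (hj : j ∉ L) : inner ℝ (b j) v = 0 :=
  inner_eq_zero_of_mem_freeSpace hv (Finset.mem_insert_of_mem
    (Finset.mem_union_left _ (Finset.mem_image_of_mem _ (Finset.mem_compl.2 hj))))

-- The free space lies in the span of the b j with j ∈ L. The resulting bound does not see the
-- frozen set, so it is the same at every step of the walk.
variable (b L F) in
theorem norm_starProjection_freeSpace_sq_le (u : EuclideanSpace ℝ ι) :
    ‖(freeSpace b L F).starProjection u‖ ^ 2 ≤ ∑ j ∈ L, inner ℝ (b j) u ^ 2 := by
  set p := (freeSpace b L F).starProjection u with hp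
  have hpm : p ∈ freeSpace b L F := Submodule.starProjection_apply_mem _ _
  have h1 : ‖p‖ ^ 2 = inner ℝ p u := by
    rw [← real_inner_self_eq_norm_sq]
    nth_rw 2 [hp]
    rw [← Submodule.inner_starProjection_left_eq_right, Submodule.starProjection_eq_self_iff.2 hpm]
  have h2 : inner ℝ p u = ∑ j ∈ L, inner ℝ (b j) p * inner ℝ (b j) u := by
    rw [← b.sum_inner_mul_inner p u]
    symm
    refine Finset.sum_subset_zero_on_sdiff (Finset.subset_univ L) (fun j hj => ?_) fun j _ => ?_
    · rw [real_inner_comm, inner_basis_eq_zero_of_mem_freeSpace hpm (by simpa using hj), zero_mul]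
    · rw [real_inner_comm p]
  have h3 : ∑ j ∈ L, inner ℝ (b j) p ^ 2 ≤ ‖p‖ ^ 2 := by
    rw [← b.sum_sq_inner_right p]
    exact Finset.sum_le_sum_of_subset_of_nonneg (Finset.subset_univ _) fun _ _ _ => sq_nonneg _
  have h4 := Finset.sum_mul_sq_le_sq_mul_sq L (fun j => inner ℝ (b j) p) (fun j => inner ℝ (b j) u)
  rw [← h2, ← h1] at h4
  have h5 : 0 ≤ ∑ j ∈ L, inner ℝ (b j) u ^ 2 := Finset.sum_nonneg fun _ _ => sq_nonneg _
  have h6 : (‖p‖ ^ 2) ^ 2 ≤ ‖p‖ ^ 2 * ∑ j ∈ L, inner ℝ (b j) u ^ 2 :=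
    h4.trans (mul_le_mul_of_nonneg_right h3 h5)
  by_contra hcon
  push Not at hcon
  nlinarith

end Walk

section Walk

variable {ι : Type} [Fintype ι] [DecidableEq ι]
  (b : OrthonormalBasis ι ℝ (EuclideanSpace ℝ ι)) (L : Finset ι)

/-- One step of the walk from `z` with signs `ξ` and step size `δ`. -/
noncomputable def walkStep (B η δ : ℝ) (z : EuclideanSpace ℝ ι) (ξ : ι → Bool) :
    EuclideanSpace ℝ ι :=
  z + δ • (freeSpace b L (frozen B η z)).starProjection (signVec ξ)

theorem walkStep_sum (B η δ : ℝ) (z : EuclideanSpace ℝ ι) (ξ : ι → Bool) :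
    ∑ x, walkStep b L B η δ z ξ x = ∑ x, z x := by
  have := sum_eq_zero_of_mem_freeSpace (b := b) (L := L) (F := frozen B η z)
    (Submodule.starProjection_apply_mem _ (signVec ξ))
  simp only [walkStep, PiLp.add_apply, PiLp.smul_apply, smul_eq_mul]
  rw [Finset.sum_add_distrib, ← Finset.mul_sum, this, mul_zero, add_zero]

theorem walkStep_of_mem_frozen {B η : ℝ} (δ : ℝ) {z : EuclideanSpace ℝ ι} (ξ : ι → Bool) {x : ι}
    (hx : x ∈ frozen B η z) : walkStep b L B η δ z ξ x = z x := by
  have := apply_eq_zero_of_mem_freeSpace (b := b) (L := L) (F := frozen B η z)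
    (Submodule.starProjection_apply_mem _ (signVec ξ)) hx
  simp only [walkStep, PiLp.add_apply, PiLp.smul_apply, smul_eq_mul]
  rw [this, mul_zero, add_zero]

theorem frozen_subset_frozen_walkStep (B η δ : ℝ) (z : EuclideanSpace ℝ ι) (ξ : ι → Bool) :
    frozen B η z ⊆ frozen B η (walkStep b L B η δ z ξ) := by
  intro x hx
  have h := walkStep_of_mem_frozen b L δ ξ hx
  rw [mem_frozen] at hx ⊢
  rwa [h]

/-- A step moves each coordinate by at most δ√|ι| ≤ η, the distance that an unfrozen coordinate
keeps from the boundary. -/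
theorem walkStep_mem_Icc {B η δ : ℝ} (hδ : 0 ≤ δ) (hδη : δ * √(Fintype.card ι) ≤ η)
    {z : EuclideanSpace ℝ ι} (hz : ∀ x, z x ∈ Set.Icc (-1) B) (ξ : ι → Bool) (x : ι) :
    walkStep b L B η δ z ξ x ∈ Set.Icc (-1) B := by
  by_cases hx : x ∈ frozen B η z
  · rw [walkStep_of_mem_frozen b L δ ξ hx]; exact hz x
  have h1 : |(freeSpace b L (frozen B η z)).starProjection (signVec ξ) x| ≤
      √(Fintype.card ι) := by
    rw [← norm_signVec_sq ξ, Real.sqrt_sq (norm_nonneg _), ← Real.norm_eq_abs]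
    exact (PiLp.norm_apply_le _ x).trans (Submodule.norm_starProjection_apply_le _ _)
  have h2 : |δ * (freeSpace b L (frozen B η z)).starProjection (signVec ξ) x| ≤ η := by
    rw [abs_mul, abs_of_nonneg hδ]
    exact (mul_le_mul_of_nonneg_left h1 hδ).trans hδη
  have h3 := abs_le.1 h2
  rw [mem_frozen] at hx
  push Not at hx
  simp only [walkStep, PiLp.add_apply, PiLp.smul_apply, smul_eq_mul, Set.mem_Icc]
  constructor <;> nlinarith

/-- The second factor is independent of z, so the bound iterates along the walk. -/
theorem expect_exp_inner_walkStep_le (B η δ : ℝ) (z v : EuclideanSpace ℝ ι) :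
    𝔼 ξ : ι → Bool, Real.exp (inner ℝ v (walkStep b L B η δ z ξ)) ≤
      Real.exp (inner ℝ v z) * Real.exp (δ ^ 2 * (∑ j ∈ L, inner ℝ (b j) v ^ 2) / 2) := by
  set V := freeSpace b L (frozen B η z) with hV
  have e : ∀ ξ, Real.exp (inner ℝ v (walkStep b L B η δ z ξ)) =
      Real.exp (inner ℝ v z) * Real.exp (inner ℝ (δ • V.starProjection v) (signVec ξ)) := by
    intro ξ
    rw [← Real.exp_add, walkStep, inner_add_right, inner_smul_right, real_inner_smul_left,
      ← Submodule.inner_starProjection_left_eq_right]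
  simp_rw [e]
  rw [← Finset.mul_expect]
  gcongr
  refine (expect_exp_inner_signVec_le _).trans (Real.exp_le_exp.2 ?_)
  rw [norm_smul, mul_pow, Real.norm_eq_abs, sq_abs]
  gcongr
  exact norm_starProjection_freeSpace_sq_le b L _ v

/-- The cross term has mean zero: energy grows by δ² per free dimension. -/
theorem expect_norm_walkStep_sq (B η δ : ℝ) (z : EuclideanSpace ℝ ι) :
    𝔼 ξ : ι → Bool, ‖walkStep b L B η δ z ξ‖ ^ 2 =
      ‖z‖ ^ 2 + δ ^ 2 * Module.finrank ℝ (freeSpace b L (frozen B η z)) := by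
  set V := freeSpace b L (frozen B η z) with hV
  have e : ∀ ξ, ‖walkStep b L B η δ z ξ‖ ^ 2 = ‖z‖ ^ 2 +
      (2 * δ) * inner ℝ (V.starProjection z) (signVec ξ) +
        δ ^ 2 * ‖V.starProjection (signVec ξ)‖ ^ 2 := by
    intro ξ
    rw [walkStep, norm_add_sq_real, inner_smul_right, Submodule.inner_starProjection_left_eq_right,
      norm_smul, mul_pow, Real.norm_eq_abs, sq_abs]
    ring
  simp_rw [e]
  rw [Finset.expect_add_distrib, Finset.expect_add_distrib, ← Finset.mul_expect,
    ← Finset.mul_expect, expect_inner_signVec, expect_norm_starProjection_signVec_sq,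
    Fintype.expect_const]
  ring

open Classical in
/-- The law of the walk after `N` steps, as a uniform mixture over a finite sample space. -/
theorem exists_walk {B η δ D : ℝ} {m : ℕ} (hB : 0 ≤ B) (hδ : 0 ≤ δ)
    (hδη : δ * √(Fintype.card ι) ≤ η) (hD : 0 ≤ D)
    (hfree : ∀ F : Finset ι, F.card < m → D ≤ Module.finrank ℝ (freeSpace b L F)) (N : ℕ) :
    ∃ (Ω : Type) (_ : Fintype Ω) (_ : Nonempty Ω) (z : Ω → EuclideanSpace ℝ ι),
      (∀ ω x, z ω x ∈ Set.Icc (-1) B) ∧ (∀ ω, ∑ x, z ω x = 0) ∧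
      (∀ v, 𝔼 ω, Real.exp (inner ℝ v (z ω)) ≤
        Real.exp (N * δ ^ 2 * (∑ j ∈ L, inner ℝ (b j) v ^ 2) / 2)) ∧
      N * δ ^ 2 * D * (𝔼 ω, if (frozen B η (z ω)).card < m then 1 else 0) ≤ 𝔼 ω, ‖z ω‖ ^ 2 := by
  induction N with
  | zero =>
    refine ⟨Unit, inferInstance, inferInstance, fun _ => 0, ?_, ?_, ?_, ?_⟩
    · intro _ x; simp [hB]
    · simp
    · simp
    · simp
  | succ N ih =>
    obtain ⟨Ω, _, _, z, h1, h2, h3, h4⟩ := ih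
    refine ⟨Ω × (ι → Bool), inferInstance, inferInstance,
      fun p => walkStep b L B η δ (z p.1) p.2, ?_, ?_, ?_, ?_⟩
    · exact fun p x => walkStep_mem_Icc b L hδ hδη (h1 p.1) p.2 x
    · exact fun p => (walkStep_sum b L B η δ (z p.1) p.2).trans (h2 p.1)
    · intro v
      rw [← Finset.univ_product_univ, Finset.expect_product]
      refine (Finset.expect_le_expect fun ω _ =>
        expect_exp_inner_walkStep_le b L B η δ (z ω) v).trans ?_
      rw [← Finset.expect_mul]
      refine (mul_le_mul_of_nonneg_right (h3 v) (Real.exp_pos _).le).trans ?_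
      rw [← Real.exp_add]
      apply le_of_eq
      congr 1
      push_cast
      ring
    · have e1 : 𝔼 p : Ω × (ι → Bool), ‖walkStep b L B η δ (z p.1) p.2‖ ^ 2 =
          𝔼 ω, ‖z ω‖ ^ 2 +
            𝔼 ω, δ ^ 2 * (Module.finrank ℝ (freeSpace b L (frozen B η (z ω))) : ℝ) := by
        rw [← Finset.univ_product_univ, Finset.expect_product, ← Finset.expect_add_distrib]
        exact Finset.expect_congr rfl fun ω _ => expect_norm_walkStep_sq b L B η δ (z ω)
      -- The frozen set only grows, so the probability of having few frozen coordinates decreases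
      -- and its latest value bounds the gain of every earlier step.
      have e2 : 𝔼 p : Ω × (ι → Bool),
          (if (frozen B η (walkStep b L B η δ (z p.1) p.2)).card < m then (1 : ℝ) else 0) ≤
          𝔼 ω, if (frozen B η (z ω)).card < m then (1 : ℝ) else 0 := by
        rw [← Finset.univ_product_univ, Finset.expect_product]
        refine Finset.expect_le_expect fun ω _ => ?_
        rw [← Fintype.expect_const (ι := ι → Bool)
          (if (frozen B η (z ω)).card < m then (1 : ℝ) else 0)]
        refine Finset.expect_le_expect fun ξ _ => ?_
        have := Finset.card_le_card (frozen_subset_frozen_walkStep b L B η δ (z ω) ξ)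
        simp only
        split_ifs <;> first | omega | norm_num
      have e3 : δ ^ 2 * D * (𝔼 ω, if (frozen B η (z ω)).card < m then 1 else 0) ≤
          𝔼 ω, δ ^ 2 * (Module.finrank ℝ (freeSpace b L (frozen B η (z ω))) : ℝ) := by
        rw [Finset.mul_expect]
        refine Finset.expect_le_expect fun ω _ => ?_
        split_ifs with hm
        · rw [mul_one]; gcongr; exact hfree _ hm
        · rw [mul_zero]; positivity
      rw [e1]
      refine (mul_le_mul_of_nonneg_left e2 (by positivity)).trans ?_
      refine le_trans (le_of_eq ?_) (add_le_add h4 e3)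
      push_cast
      ring

/-- A balanced vector in `[-1, B]` most of whose coordinates are near the boundary has negative
part of nearly maximal mass. -/
theorem le_sum_negPart_of_frozen {B η κ : ℝ} (hB : 1 ≤ B) (hη1 : η ≤ 1)
    {z : EuclideanSpace ℝ ι}
    (hz : ∀ x, z x ∈ Set.Icc (-1) B) (hz0 : ∑ x, z x = 0)
    (hF : (1 - κ) * Fintype.card ι ≤ (frozen B η z).card) :
    (1 - η) * ((1 - κ - 1 / B) * Fintype.card ι) ≤ ∑ x, max (-z x) 0 := by
  classical
  set P : Finset ι := {x | B - η < z x} with hP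
  set M : Finset ι := {x | z x < -1 + η} with hM
  have hcard : (frozen B η z).card ≤ M.card + P.card := by
    refine (Finset.card_le_card fun x hx => ?_).trans (Finset.card_union_le M P)
    rw [mem_frozen] at hx
    simpa [hM, hP] using hx
  -- Markov's inequality for z + 1 ≥ 0, which has total |ι| and exceeds B − η + 1 ≥ B on P.
  have hPc : (P.card : ℝ) * B ≤ Fintype.card ι := by
    have h1 : ∑ x, (if x ∈ P then B - η + 1 else 0) ≤ ∑ x, (z x + 1) := by
      refine Finset.sum_le_sum fun x _ => ?_
      have := (hz x).1
      split_ifs with hx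
      · simp only [hP, Finset.mem_filter, Finset.mem_univ, true_and] at hx; linarith
      · linarith
    have h2 : ∑ x, (z x + 1) = Fintype.card ι := by
      rw [Finset.sum_add_distrib, hz0]; simp
    rw [Finset.sum_ite_mem, Finset.univ_inter, h2, Finset.sum_const, nsmul_eq_mul] at h1
    nlinarith [(Nat.cast_nonneg P.card : (0 : ℝ) ≤ _)]
  have hPc' : (P.card : ℝ) ≤ 1 / B * Fintype.card ι := by
    rw [one_div, inv_mul_eq_div, le_div_iff₀ (by linarith)]; exact hPc
  have hMc : (1 - κ - 1 / B) * Fintype.card ι ≤ M.card := by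
    have : ((frozen B η z).card : ℝ) ≤ M.card + P.card := by exact_mod_cast hcard
    linarith
  calc (1 - η) * ((1 - κ - 1 / B) * Fintype.card ι) ≤ (1 - η) * M.card :=
        mul_le_mul_of_nonneg_left hMc (by linarith)
    _ = ∑ x, (if x ∈ M then 1 - η else 0) := by
        rw [Finset.sum_ite_mem, Finset.univ_inter, Finset.sum_const, nsmul_eq_mul, mul_comm]
    _ ≤ _ := by
        refine Finset.sum_le_sum fun x _ => ?_
        split_ifs with hx
        · simp only [hM, Finset.mem_filter, Finset.mem_univ, true_and] at hx
          exact le_max_of_le_left (by linarith)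
        · exact le_max_right _ _

open Classical in
/-- A random perturbation, far from zero with probability at least `1/2`, that is subgaussian
along a prescribed coordinate subspace of nearly full dimension. -/
theorem exists_subgaussian_perturbation [Nonempty ι] {θ : ℝ} (hθ : 0 < θ) (hθ1 : θ ≤ 1)
    (hL : (Lᶜ.card : ℝ) ≤ θ * Fintype.card ι) (hk : 1 ≤ θ * Fintype.card ι)
    {t : ℕ} (ht : 2 / θ ^ 3 ≤ t) :
    ∃ (Ω : Type) (_ : Fintype Ω) (_ : Nonempty Ω) (z : Ω → EuclideanSpace ℝ ι),
      (∀ ω x, -1 ≤ z ω x) ∧ (∀ ω, ∑ x, z ω x = 0) ∧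
      (∀ v, 𝔼 ω, Real.exp (inner ℝ v (z ω)) ≤
        Real.exp (t * (∑ j ∈ L, inner ℝ (b j) v ^ 2) / 2)) ∧
      1 / 2 ≤ 𝔼 ω, if (1 - θ) * ((1 - 4 * θ) * Fintype.card ι) ≤ ∑ x, max (-z ω x) 0
        then (1 : ℝ) else 0 := by
  set K : ℝ := (Fintype.card ι : ℝ) with hK
  have hK0 : 0 < K := by rw [hK]; exact_mod_cast Fintype.card_pos
  -- The step size 1/r is small enough not to cross the boundary layer of width θ; t r² steps amount
  -- to time t.
  obtain ⟨r, hr⟩ := exists_nat_gt (√K / θ)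
  have hr0 : (0 : ℝ) < r := lt_of_le_of_lt (by positivity) hr
  set m : ℕ := ⌈(1 - 3 * θ) * K⌉₊ with hm
  -- The losses are at most θK for the discarded basis vectors, 1 ≤ θK for balance, and (1 − 3θ)K
  -- for F.
  have hfree : ∀ F : Finset ι, F.card < m → θ * K ≤ Module.finrank ℝ (freeSpace b L F) := by
    intro F hF
    have h1 : (F.card : ℝ) < (1 - 3 * θ) * K := Nat.lt_ceil.1 hF
    have h2 : K ≤ Module.finrank ℝ (freeSpace b L F) + (1 + Lᶜ.card + F.card) := by
      rw [hK]; exact_mod_cast card_le_finrank_freeSpace b L F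
    linarith
  have hB : 1 ≤ 1 / θ := by rw [le_div_iff₀ hθ]; linarith
  obtain ⟨Ω, i1, i2, z, h1, h2, h3, h4⟩ := exists_walk b L (B := 1 / θ) (η := θ) (δ := 1 / r)
    (D := θ * K) (m := m) (by linarith) (by positivity)
    (by
      rw [div_lt_iff₀ hθ] at hr
      rw [one_div, inv_mul_le_iff₀ hr0]; exact hr.le)
    (by positivity) hfree (t * r ^ 2)
  have e : ((t * r ^ 2 : ℕ) : ℝ) * (1 / r) ^ 2 = t := by push_cast; field_simp
  rw [e] at h4
  simp_rw [e] at h3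
  refine ⟨Ω, i1, i2, z, fun ω x => (h1 ω x).1, h2, h3, ?_⟩
  have hn : 𝔼 ω, ‖z ω‖ ^ 2 ≤ K * (1 / θ) ^ 2 := by
    refine Finset.expect_le Finset.univ_nonempty fun ω _ => ?_
    rw [EuclideanSpace.norm_sq_eq]
    calc ∑ x, ‖z ω x‖ ^ 2 ≤ ∑ _x : ι, (1 / θ) ^ 2 := by
          refine Finset.sum_le_sum fun x _ => ?_
          have := h1 ω x
          rw [Real.norm_eq_abs]
          exact pow_le_pow_left₀ (abs_nonneg _) (abs_le.2 ⟨by linarith [this.1], this.2⟩) 2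
      _ = _ := by simp [hK]
  set p : ℝ := 𝔼 ω, if (frozen (1 / θ) θ (z ω)).card < m then (1 : ℝ) else 0 with hp
  -- The energy is at least tθK·p and at most K/θ², whence the threshold 2/θ³ for t.
  have hp2 : p ≤ 1 / 2 := by
    have h5 := h4.trans hn
    have h6 : 2 / θ ^ 3 * (θ * K) ≤ t * (θ * K) := by gcongr
    by_contra hcon
    push Not at hcon
    have h7 : 2 / θ ^ 3 * (θ * K) * (1 / 2) < t * (θ * K) * p := by
      have : 0 < 2 / θ ^ 3 * (θ * K) := by positivity
      nlinarith
    have h8 : 2 / θ ^ 3 * (θ * K) * (1 / 2) = K * (1 / θ) ^ 2 := by field_simp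
    linarith
  have hq : 1 ≤ p + 𝔼 ω, if (1 - θ) * ((1 - 4 * θ) * K) ≤ ∑ x, max (-z ω x) 0
        then (1 : ℝ) else 0 := by
    rw [hp, ← Finset.expect_add_distrib]
    refine (Fintype.expect_const (ι := Ω) (1 : ℝ)).symm.le.trans ?_
    refine Finset.expect_le_expect fun ω _ => ?_
    by_cases hf : (frozen (1 / θ) θ (z ω)).card < m
    · rw [if_pos hf]; split_ifs <;> norm_num
    · have hf' : (1 - 3 * θ) * K ≤ (frozen (1 / θ) θ (z ω)).card := Nat.ceil_le.1 (not_lt.1 hf)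
      have h9 := le_sum_negPart_of_frozen hB hθ1 (h1 ω) (h2 ω) hf'
      rw [one_div_one_div] at h9
      rw [if_neg hf, if_pos (by convert h9 using 3; ring), zero_add]
  linarith

end Walk

/-! ### Channel information operators -/

section ChannelOperator

variable {X Y : Type*} [Fintype X]

/-- The column of the channel `W` at the output `y`. -/
noncomputable def channelCol (W : X → Y → ℝ) (y : Y) : EuclideanSpace ℝ X :=
  WithLp.toLp 2 fun x => W x y

theorem inner_channelCol (W : X → Y → ℝ) (y : Y) (v : EuclideanSpace ℝ X) :
    inner ℝ (channelCol W y) v = ∑ x, v x * W x y := by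
  rw [PiLp.inner_apply]; simp [channelCol]

variable [Fintype Y]

/-- The channel information operator `∑ y, W_y W_yᵀ / ∑ x, W x y`. -/
noncomputable def channelOp (W : X → Y → ℝ) : EuclideanSpace ℝ X →ₗ[ℝ] EuclideanSpace ℝ X :=
  ∑ y, (∑ x, W x y)⁻¹ •
    ((innerSL ℝ (channelCol W y)).toLinearMap.smulRight (channelCol W y))

theorem inner_channelOp (W : X → Y → ℝ) (v w : EuclideanSpace ℝ X) :
    inner ℝ v (channelOp W w) =
      ∑ y, (∑ x, v x * W x y) * (∑ x, w x * W x y) / ∑ x, W x y := by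
  simp only [channelOp, LinearMap.sum_apply, LinearMap.smul_apply, LinearMap.smulRight_apply,
    inner_sum, inner_smul_right]
  refine Finset.sum_congr rfl fun y _ => ?_
  rw [real_inner_comm, ← inner_channelCol, ← inner_channelCol]
  simp only [ContinuousLinearMap.coe_coe, innerSL_apply_apply]
  ring

theorem channelOp_isSymmetric (W : X → Y → ℝ) : (channelOp W).IsSymmetric := by
  intro v w
  rw [real_inner_comm, inner_channelOp, inner_channelOp]
  exact Finset.sum_congr rfl fun y _ => by ring

variable {W : X → Y → ℝ}

theorem inner_channelOp_self_nonneg (hW : ∀ x y, 0 ≤ W x y) (v : EuclideanSpace ℝ X) :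
    0 ≤ inner ℝ v (channelOp W v) := by
  rw [inner_channelOp]
  exact Finset.sum_nonneg fun y _ =>
    div_nonneg (mul_self_nonneg _) (Finset.sum_nonneg fun x _ => hW x y)

/-- Cauchy–Schwarz at each output: averaging over inputs contracts the L² norm. -/
theorem inner_channelOp_self_le (hW : ∀ x y, 0 ≤ W x y) (hW1 : ∀ x, ∑ y, W x y = 1)
    (v : EuclideanSpace ℝ X) : inner ℝ v (channelOp W v) ≤ ‖v‖ ^ 2 := by
  rw [inner_channelOp, EuclideanSpace.norm_sq_eq]
  have h1 : ∀ y, (∑ x, v x * W x y) * (∑ x, v x * W x y) / ∑ x, W x y ≤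
      ∑ x, v x ^ 2 * W x y := by
    intro y
    have h0 : 0 ≤ ∑ x, W x y := Finset.sum_nonneg fun x _ => hW x y
    have h3 : 0 ≤ ∑ x, v x ^ 2 * W x y :=
      Finset.sum_nonneg fun x _ => mul_nonneg (sq_nonneg _) (hW x y)
    refine div_le_of_le_mul₀ h0 h3 ?_
    have h2 := Finset.sum_mul_sq_le_sq_mul_sq Finset.univ (fun x => v x * √(W x y))
      (fun x => √(W x y))
    simp_rw [mul_pow, Real.sq_sqrt (hW _ y), mul_assoc, Real.mul_self_sqrt (hW _ y)] at h2
    rwa [sq] at h2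
  refine (Finset.sum_le_sum fun y _ => h1 y).trans (le_of_eq ?_)
  rw [Finset.sum_comm]
  simp_rw [← Finset.mul_sum, hW1]
  simp

/-- Each output contributes trace (∑ W²)/(∑ W) ≤ 1, because W ≤ 1. -/
theorem sum_inner_channelOp_le_card_output {J : Type*} [Fintype J] (hW : ∀ x y, 0 ≤ W x y)
    (hW1 : ∀ x, ∑ y, W x y = 1) (b : OrthonormalBasis J ℝ (EuclideanSpace ℝ X)) :
    ∑ j, inner ℝ (b j) (channelOp W (b j)) ≤ Fintype.card Y := by
  simp_rw [inner_channelOp, ← inner_channelCol]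
  rw [Finset.sum_comm]
  have h1 : ∀ y, ∑ j, inner ℝ (channelCol W y) (b j) * inner ℝ (channelCol W y) (b j) /
      ∑ x, W x y ≤ 1 := by
    intro y
    have h0 : 0 ≤ ∑ x, W x y := Finset.sum_nonneg fun x _ => hW x y
    rw [← Finset.sum_div]
    refine div_le_of_le_mul₀ h0 zero_le_one ?_
    simp_rw [← sq]
    rw [b.sum_sq_inner_left, EuclideanSpace.norm_sq_eq, one_mul]
    refine Finset.sum_le_sum fun x _ => ?_
    have h2 : W x y ≤ 1 := by
      rw [← hW1 x]; exact Finset.single_le_sum (fun y _ => hW x y) (Finset.mem_univ y)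
    simp only [channelCol, Real.norm_eq_abs, sq_abs]
    nlinarith [hW x y]
  exact (Finset.sum_le_sum fun y _ => h1 y).trans (by simp)

theorem sum_inner_channelOp_le_card_input {J : Type*} [Fintype J] (hW : ∀ x y, 0 ≤ W x y)
    (hW1 : ∀ x, ∑ y, W x y = 1) (b : OrthonormalBasis J ℝ (EuclideanSpace ℝ X)) :
    ∑ j, inner ℝ (b j) (channelOp W (b j)) ≤ Fintype.card X := by
  refine (Finset.sum_le_sum fun j _ => inner_channelOp_self_le hW hW1 (b j)).trans ?_
  have := Module.finrank_eq_card_basis b.toBasis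
  rw [finrank_euclideanSpace] at this
  simp [b.orthonormal.1, this]

end ChannelOperator

/-! ### A low-energy subspace common to all seeds -/

/-- A positive operator that is at most `ρ` on the span of the family `f` satisfies
`∑ l, ⟪f l, A x⟫² ≤ ρ ⟪x, A x⟫`. -/
theorem sum_inner_sq_le_of_le {V J : Type*} [NormedAddCommGroup V] [InnerProductSpace ℝ V]
    [Fintype J] {f : J → V} {A : V →ₗ[ℝ] V} (hA : A.IsSymmetric)
    (hA0 : ∀ v, 0 ≤ inner ℝ v (A v)) {ρ : ℝ}
    (hρ : ∀ c : J → ℝ, inner ℝ (∑ l, c l • f l) (A (∑ l, c l • f l)) ≤ ρ * ∑ l, c l ^ 2)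
    (hρ0 : 0 ≤ ρ) (x : V) :
    ∑ l, inner ℝ (f l) (A x) ^ 2 ≤ ρ * inner ℝ x (A x) := by
  set c : J → ℝ := fun l => inner ℝ (f l) (A x) with hc
  have h1 : inner ℝ (∑ l, c l • f l) (A x) = ∑ l, c l ^ 2 := by
    simp_rw [sum_inner, real_inner_smul_left, sq, hc]
  -- Cauchy–Schwarz for the semi-inner product ⟨v, A w⟩, tested on the combination of the f l with
  -- coefficients ⟨f l, A x⟩.
  have h2 := LinearMap.BilinForm.apply_sq_le_of_symm
    ((innerₗ V).compl₂ A) (fun v => by simpa using hA0 v)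
    ⟨fun v w => by simpa using (hA w v).symm ▸ real_inner_comm _ _⟩ (∑ l, c l • f l) x
  simp only [LinearMap.compl₂_apply, innerₗ_apply_apply, h1] at h2
  have h3 := h2.trans (mul_le_mul_of_nonneg_right (hρ c) (hA0 x))
  have h4 : 0 ≤ ρ * inner ℝ x (A x) := mul_nonneg hρ0 (hA0 x)
  have h5 : 0 ≤ ∑ l, c l ^ 2 := Finset.sum_nonneg fun _ _ => sq_nonneg _
  by_contra hcon
  push Not at hcon
  nlinarith

/-- A common subspace, of nearly full dimension, on which all the compressions of a finite family
of positive operators have small Hilbert–Schmidt norm. -/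
theorem exists_low_spectral_subspace {k : ℕ} {U : Type*} [Fintype U] [Nonempty U]
    (A : U → EuclideanSpace ℝ (Fin k) →ₗ[ℝ] EuclideanSpace ℝ (Fin k))
    (hA : ∀ u, (A u).IsSymmetric) (hA0 : ∀ u v, 0 ≤ inner ℝ v (A u v)) {N T κ : ℝ} (hN : 0 ≤ N)
    (hT : 0 ≤ T) (hκ : 0 < κ) (hk : 0 < k)
    (hAN : ∀ u v, inner ℝ v (A u v) ≤ N * ‖v‖ ^ 2)
    (hAT : ∀ u (b : OrthonormalBasis (Fin k) ℝ (EuclideanSpace ℝ (Fin k))),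
      ∑ j, inner ℝ (b j) (A u (b j)) ≤ N * T) :
    ∃ (b : OrthonormalBasis (Fin k) ℝ (EuclideanSpace ℝ (Fin k))) (L : Finset (Fin k)),
      (Lᶜ.card : ℝ) ≤ κ * k ∧
      ∀ u, ∑ j : L, ∑ l : L, inner ℝ (b l) (A u (b j)) ^ 2 ≤
        N ^ 2 * T * min 1 (Fintype.card U * T / (κ * k)) := by
  classical
  set S := ∑ u, A u with hS
  have hSs : S.IsSymmetric := by
    intro v w
    simp only [hS, LinearMap.sum_apply, inner_sum, sum_inner]
    exact Finset.sum_congr rfl fun u _ => hA u v w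
  have hSv : ∀ v, inner ℝ v (S v) = ∑ u, inner ℝ v (A u v) := fun v => by
    simp only [hS, LinearMap.sum_apply, inner_sum]
  set b := hSs.eigenvectorBasis (finrank_euclideanSpace_fin (𝕜 := ℝ) (n := k)) with hb
  set ev := hSs.eigenvalues (finrank_euclideanSpace_fin (𝕜 := ℝ) (n := k)) with hev
  have hSb : ∀ j, S (b j) = ev j • b j := fun j => hSs.apply_eigenvectorBasis _ j
  have hbb : ∀ i j, inner ℝ (b i) (b j) = if i = j then (1 : ℝ) else 0 :=
    orthonormal_iff_ite.1 b.orthonormal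
  have hevj : ∀ j, ev j = ∑ u, inner ℝ (b j) (A u (b j)) := fun j => by
    rw [← hSv, hSb, inner_smul_right, hbb]; simp
  have hev0 : ∀ j, 0 ≤ ev j := fun j => by
    rw [hevj]; exact Finset.sum_nonneg fun u _ => hA0 u _
  set C : ℝ := Fintype.card U * (N * T) with hC
  have hC0 : 0 ≤ C := by positivity
  have hevsum : ∑ j, ev j ≤ C := by
    simp_rw [hevj]
    rw [Finset.sum_comm]
    exact (Finset.sum_le_sum fun u _ => hAT u b).trans (by simp [hC])
  have hk0 : (0 : ℝ) < k := by exact_mod_cast hk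
  set r : ℝ := C / (κ * k) with hr
  have hr0 : 0 ≤ r := by positivity
  -- By Markov's inequality at most κk eigenvalues of S exceed r.
  set L : Finset (Fin k) := {j | ev j ≤ r} with hL
  refine ⟨b, L, ?_, ?_⟩
  · have h1 : (Lᶜ.card : ℝ) * r ≤ C := by
      calc (Lᶜ.card : ℝ) * r = ∑ j ∈ Lᶜ, r := by simp
        _ ≤ ∑ j ∈ Lᶜ, ev j := Finset.sum_le_sum fun j hj => by
            simp only [hL, Finset.mem_compl, Finset.mem_filter, Finset.mem_univ, true_and,
              not_le] at hj
            exact hj.le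
        _ ≤ ∑ j, ev j := Finset.sum_le_univ_sum_of_nonneg hev0
        _ ≤ C := hevsum
    rcases hC0.eq_or_lt with hC1 | hC1
    · have h2 : ∀ j, ev j = 0 := by
        intro j
        refine (Finset.sum_eq_zero_iff_of_nonneg fun j _ => hev0 j).1 ?_ j (Finset.mem_univ j)
        exact le_antisymm (hevsum.trans hC1.ge) (Finset.sum_nonneg fun j _ => hev0 j)
      have h3 : L = Finset.univ := by
        ext j; simp [hL, h2, hr0]
      rw [h3]; simp; positivity
    · rw [hr, mul_div_assoc', div_le_iff₀ (by positivity)] at h1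
      by_contra hcon
      push Not at hcon
      nlinarith
  · intro u
    have hf : Orthonormal ℝ fun l : L => b l := b.orthonormal.comp _ Subtype.val_injective
    have hnorm : ∀ c : L → ℝ, ‖∑ l, c l • b l‖ ^ 2 = ∑ l, c l ^ 2 := fun c => by
      rw [← real_inner_self_eq_norm_sq, hf.inner_sum]
      simp [sq]
    have hSc : ∀ c : L → ℝ, inner ℝ (∑ l : L, c l • b l) (S (∑ l : L, c l • b l)) =
        ∑ l : L, ev l * c l ^ 2 := fun c => by
      have : S (∑ l : L, c l • b l) = ∑ l : L, (ev l * c l) • b l := by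
        rw [map_sum]
        refine Finset.sum_congr rfl fun l _ => ?_
        rw [map_smul, hSb, smul_smul, mul_comm]
      rw [this, hf.inner_sum (𝕜 := ℝ) c (fun l => ev l * c l)]
      refine Finset.sum_congr rfl fun l _ => ?_
      simp; ring
    have htr : ∑ j : L, inner ℝ (b j) (A u (b j)) ≤ N * T := by
      rw [Finset.sum_coe_sort L fun j => inner ℝ (b j) (A u (b j))]
      exact (Finset.sum_le_univ_sum_of_nonneg fun j => hA0 u _).trans (hAT u b)
    have key : ∀ ρ : ℝ, 0 ≤ ρ → (∀ c : L → ℝ, inner ℝ (∑ l, c l • b l)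
        (A u (∑ l, c l • b l)) ≤ ρ * ∑ l, c l ^ 2) →
        ∑ j : L, ∑ l : L, inner ℝ (b l) (A u (b j)) ^ 2 ≤ ρ * (N * T) := by
      intro ρ hρ0 hρ
      refine (Finset.sum_le_sum fun (j : L) _ =>
        sum_inner_sq_le_of_le (hA u) (hA0 u) hρ hρ0 (b j)).trans ?_
      rw [← Finset.mul_sum]
      exact mul_le_mul_of_nonneg_left htr hρ0
    rw [mul_min_of_nonneg _ _ (by positivity)]
    -- Two bounds on A u over the span of L: its norm bound N, and r, since A u ≤ S.
    refine le_min ?_ ?_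
    · refine (key N hN fun c => ?_).trans (le_of_eq (by ring))
      rw [← hnorm]; exact hAN u _
    · refine (key r hr0 fun c => ?_).trans (le_of_eq ?_)
      · calc _ ≤ inner ℝ (∑ l, c l • b l) (S (∑ l, c l • b l)) := by
              rw [hSv]
              exact Finset.single_le_sum (f := fun u => inner ℝ (∑ l, c l • b l)
                (A u (∑ l, c l • b l))) (fun u _ => hA0 u _) (Finset.mem_univ u)
          _ ≤ _ := by
              rw [hSc, Finset.mul_sum]
              refine Finset.sum_le_sum fun l _ => mul_le_mul_of_nonneg_right ?_ (sq_nonneg _)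
              exact (Finset.mem_filter.1 l.2).2
      · simp only [hr, hC]; field_simp

/-! ### From protocols to averaged real channels -/

namespace SCoinProtocol

variable {k ℓ s n : ℕ}

/-- The channel of user `i` given the seed `u`, averaged over the private randomness. -/
noncomputable def meanChannel (P : SCoinProtocol k ℓ s n) (u : Fin s → Bool) (i : Fin n)
    (x : Fin k) (y : Fin ℓ → Bool) : ℝ≥0∞ :=
  ∫⁻ ω, P.channel u i ω x y ∂(P.privLaw i)

/-- Private coins are independent across users, so they can be absorbed into the channels one user
at a time. -/
theorem messageProb_eq_prod (P : SCoinProtocol k ℓ s n) (u : Fin s → Bool)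
    (x : Fin n → Fin k) (y : Fin n → Fin ℓ → Bool) :
    P.messageProb u x y = ∏ i, P.meanChannel u i (x i) (y i) := by
  have h := ProbabilityTheory.iIndepFun_pi (μ := P.privLaw)
    (X := fun i ω => P.channel u i ω (x i) (y i))
    (fun i => (P.measurable_channel u i (x i) (y i)).aemeasurable)
  rw [messageProb, ProbabilityTheory.lintegral_prod_eq_prod_lintegral_of_indepFun _ _ h
    (fun i => (P.measurable_channel u i (x i) (y i)).comp (measurable_pi_apply i))]
  exact Finset.prod_congr rfl fun i _ => (measurePreserving_eval P.privLaw i).lintegral_comp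
    (P.measurable_channel u i (x i) (y i))

theorem sum_meanChannel (P : SCoinProtocol k ℓ s n) (u : Fin s → Bool) (i : Fin n)
    (x : Fin k) : ∑ y, P.meanChannel u i x y = 1 := by
  simp only [meanChannel]
  rw [← lintegral_finsetSum _ fun y _ => P.measurable_channel u i x y]
  have : ∀ ω, ∑ y, P.channel u i ω x y = 1 := fun ω => by
    have := (P.channel u i ω x).tsum_coe
    rwa [tsum_fintype] at this
  simp [this]

theorem meanChannel_ne_top (P : SCoinProtocol k ℓ s n) (u : Fin s → Bool) (i : Fin n)
    (x : Fin k) (y : Fin ℓ → Bool) : P.meanChannel u i x y ≠ ⊤ := by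
  refine ne_top_of_le_ne_top ENNReal.one_ne_top ?_
  rw [← P.sum_meanChannel u i x]
  exact Finset.single_le_sum (fun _ _ => zero_le) (Finset.mem_univ y)

/-- The real-valued version of `meanChannel`. -/
noncomputable def realChannel (P : SCoinProtocol k ℓ s n) (u : Fin s → Bool) (i : Fin n)
    (x : Fin k) (y : Fin ℓ → Bool) : ℝ :=
  (P.meanChannel u i x y).toReal

theorem realChannel_nonneg (P : SCoinProtocol k ℓ s n) (u : Fin s → Bool) (i : Fin n)
    (x : Fin k) (y : Fin ℓ → Bool) : 0 ≤ P.realChannel u i x y := ENNReal.toReal_nonneg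

theorem sum_realChannel (P : SCoinProtocol k ℓ s n) (u : Fin s → Bool) (i : Fin n)
    (x : Fin k) : ∑ y, P.realChannel u i x y = 1 := by
  simp only [realChannel]
  rw [← ENNReal.toReal_sum fun y _ => P.meanChannel_ne_top u i x y, sum_meanChannel,
    ENNReal.toReal_one]

theorem toReal_outputProb (P : SCoinProtocol k ℓ s n) (p : PMF (Fin k)) (c : Bool) :
    (P.outputProb p c).toReal = 𝔼 u : Fin s → Bool,
      acceptance (P.realChannel u) (fun y => (P.server u y c).toReal) fun x => (p x).toReal := by
  have h1 : ∀ u, ∑ x : Fin n → Fin k, (∏ i, p (x i)) *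
      ∑ y : Fin n → Fin ℓ → Bool, P.messageProb u x y * P.server u y c =
      ∑ y : Fin n → Fin ℓ → Bool, P.server u y c * ∏ i, ∑ x, p x * P.meanChannel u i x (y i) := by
    intro u
    simp_rw [Finset.mul_sum]
    rw [Finset.sum_comm]
    refine Finset.sum_congr rfl fun y _ => ?_
    rw [Fintype.prod_sum (fun i x => p x * P.meanChannel u i x (y i)), Finset.mul_sum]
    refine Finset.sum_congr rfl fun x _ => ?_
    rw [messageProb_eq_prod, Finset.prod_mul_distrib]
    ring
  have h2 : ∀ u i y, ∑ x, p x * P.meanChannel u i x y ≠ ⊤ := fun u i y =>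
    ENNReal.sum_ne_top.2 fun x _ => ENNReal.mul_ne_top (p.apply_ne_top x)
      (P.meanChannel_ne_top u i x y)
  have h3 : ∀ u (y : Fin n → Fin ℓ → Bool),
      P.server u y c * ∏ i, ∑ x, p x * P.meanChannel u i x (y i) ≠ ⊤ := fun u y =>
    ENNReal.mul_ne_top ((P.server u y).apply_ne_top c) (ENNReal.prod_ne_top fun i _ => h2 u i _)
  simp only [outputProb, h1]
  rw [ENNReal.toReal_sum, Fintype.expect_eq_sum_div_card, Finset.sum_div]
  · refine Finset.sum_congr rfl fun u _ => ?_
    rw [ENNReal.toReal_mul, ENNReal.toReal_sum fun y _ => h3 u y, acceptance]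
    simp only [ENNReal.toReal_mul, ENNReal.toReal_prod, realChannel]
    have h4 : ((2 ^ s : ℝ≥0∞)⁻¹).toReal = ((Fintype.card (Fin s → Bool) : ℕ) : ℝ)⁻¹ := by simp
    rw [h4, div_eq_inv_mul]
    congr 1
    refine Finset.sum_congr rfl fun y _ => ?_
    congr 1
    refine Finset.prod_congr rfl fun i _ => ?_
    rw [ENNReal.toReal_sum fun x _ => ENNReal.mul_ne_top (p.apply_ne_top x)
      (P.meanChannel_ne_top u i x (y i))]
    simp only [ENNReal.toReal_mul]
  · intro u _
    exact ENNReal.mul_ne_top (by simp) (ENNReal.sum_ne_top.2 fun y _ => h3 u y)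

end SCoinProtocol

theorem PMF.sum_toReal {X : Type*} [Fintype X] (p : PMF X) : ∑ x, (p x).toReal = 1 := by
  have := p.tsum_coe
  rw [tsum_fintype] at this
  rw [← ENNReal.toReal_sum fun x _ => p.apply_ne_top x, this, ENNReal.toReal_one]

theorem acceptance_add_compl {ι X Y : Type*} [Fintype ι] [DecidableEq ι] [Fintype X] [Fintype Y]
    (W : ι → X → Y → ℝ) (hW1 : ∀ i x, ∑ y, W i x y = 1) (h h' : (ι → Y) → ℝ)
    (hh : ∀ y, h y + h' y = 1) (p : X → ℝ) (hp : ∑ x, p x = 1) :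
    acceptance W h p + acceptance W h' p = 1 := by
  rw [acceptance, acceptance, ← Finset.sum_add_distrib]
  simp_rw [← add_mul, hh, one_mul]
  rw [← Fintype.prod_sum (fun i y => ∑ x, p x * W i x y)]
  refine Finset.prod_eq_one fun i _ => ?_
  rw [Finset.sum_comm]
  simp_rw [← Finset.mul_sum, hW1, mul_one, hp]

theorem SCoinProtocol.toReal_outputProb_add {k ℓ s n : ℕ} (P : SCoinProtocol k ℓ s n)
    (p : PMF (Fin k)) :
    (P.outputProb p true).toReal + (P.outputProb p false).toReal = 1 := by
  rw [P.toReal_outputProb, P.toReal_outputProb, ← Finset.expect_add_distrib,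
    ← Fintype.expect_const (ι := Fin s → Bool) (1 : ℝ)]
  refine Finset.expect_congr rfl fun u _ => ?_
  refine acceptance_add_compl _ (P.sum_realChannel u) _ _ (fun y => ?_) _ p.sum_toReal
  have := (P.server u y).sum_toReal
  rwa [Fintype.sum_bool] at this

/-! ### Perturbed uniform distributions and the forced fluctuation -/

/-- A perturbation of the uniform distribution. -/
theorem exists_perturbed_uniform {k : ℕ} [NeZero k] {z : Fin k → ℝ} {γ : ℝ} (hγ0 : 0 ≤ γ)
    (hγ1 : γ ≤ 1) (hz : ∀ x, -1 ≤ z x) (hz0 : ∑ x, z x = 0) :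
    ∃ p : PMF (Fin k), (∀ x, (p x).toReal = (1 + γ * z x) / k) ∧
      γ / k * ∑ x, max (-z x) 0 ≤ tvDist p (PMF.uniformOfFintype (Fin k)) := by
  have hk : (0 : ℝ) < k := by exact_mod_cast Nat.pos_of_ne_zero (NeZero.ne k)
  have h0 : ∀ x, 0 ≤ (1 + γ * z x) / k := fun x => div_nonneg (by nlinarith [hz x]) hk.le
  have h1 : ∑ x, ENNReal.ofReal ((1 + γ * z x) / k) = 1 := by
    rw [← ENNReal.ofReal_sum_of_nonneg fun x _ => h0 x, ← Finset.sum_div,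
      Finset.sum_add_distrib, ← Finset.mul_sum, hz0]
    simp [hk.ne']
  refine ⟨PMF.ofFintype _ h1, fun x => ENNReal.toReal_ofReal (h0 x), ?_⟩
  set p := PMF.ofFintype _ h1 with hp
  have hpx : ∀ x, (p x).toReal = (1 + γ * z x) / k := fun x => ENNReal.toReal_ofReal (h0 x)
  have hux : ∀ x, (PMF.uniformOfFintype (Fin k) x).toReal = 1 / k := fun x => by simp
  have hS : ∀ S : Finset (Fin k), ∑ x ∈ S, (p x).toReal -
      ∑ x ∈ S, (PMF.uniformOfFintype (Fin k) x).toReal = γ / k * ∑ x ∈ S, z x := fun S => by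
    rw [← Finset.sum_sub_distrib, Finset.mul_sum]
    refine Finset.sum_congr rfl fun x _ => ?_
    rw [hpx, hux]; field_simp; ring
  -- By balance the negative and positive parts have equal mass; the event witnessing the distance
  -- is {z ≥ 0}.
  have hsum : ∑ x, max (-z x) 0 = ∑ x ∈ Finset.univ.filter fun x => 0 ≤ z x, z x := by
    rw [Finset.sum_filter]
    have : ∀ x, (if 0 ≤ z x then z x else 0) = max (-z x) 0 + z x := fun x => by
      split_ifs with hx
      · rw [max_eq_right (by linarith), zero_add]
      · rw [max_eq_left (by linarith)]; ring
    simp_rw [this]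
    rw [Finset.sum_add_distrib, hz0, add_zero]
  rw [hsum, ← hS]
  exact le_ciSup (f := fun S : Finset (Fin k) => ∑ x ∈ S, (p x).toReal -
    ∑ x ∈ S, (PMF.uniformOfFintype (Fin k) x).toReal) (Set.finite_range _).bddAbove _

namespace SCoinProtocol

variable {k ℓ s n : ℕ}

/-- The total channel information operator of the users given the seed `u`. -/
noncomputable def infoOp (P : SCoinProtocol k ℓ s n) (u : Fin s → Bool) :
    EuclideanSpace ℝ (Fin k) →ₗ[ℝ] EuclideanSpace ℝ (Fin k) :=
  ∑ i, channelOp (P.realChannel u i)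

theorem inner_infoOp (P : SCoinProtocol k ℓ s n) (u : Fin s → Bool)
    (v w : EuclideanSpace ℝ (Fin k)) :
    inner ℝ v (P.infoOp u w) = ∑ i, inner ℝ v (channelOp (P.realChannel u i) w) := by
  simp only [infoOp, LinearMap.sum_apply, inner_sum]

theorem infoOp_isSymmetric (P : SCoinProtocol k ℓ s n) (u : Fin s → Bool) :
    (P.infoOp u).IsSymmetric := by
  intro v w
  rw [real_inner_comm, inner_infoOp, inner_infoOp]
  refine Finset.sum_congr rfl fun i _ => ?_
  rw [← channelOp_isSymmetric, real_inner_comm]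

theorem inner_infoOp_self_nonneg (P : SCoinProtocol k ℓ s n) (u : Fin s → Bool)
    (v : EuclideanSpace ℝ (Fin k)) : 0 ≤ inner ℝ v (P.infoOp u v) := by
  rw [inner_infoOp]
  exact Finset.sum_nonneg fun i _ => inner_channelOp_self_nonneg (P.realChannel_nonneg u i) v

theorem inner_infoOp_self_le (P : SCoinProtocol k ℓ s n) (u : Fin s → Bool)
    (v : EuclideanSpace ℝ (Fin k)) : inner ℝ v (P.infoOp u v) ≤ n * ‖v‖ ^ 2 := by
  rw [inner_infoOp]
  refine (Finset.sum_le_sum fun i _ => inner_channelOp_self_le (P.realChannel_nonneg u i)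
    (P.sum_realChannel u i) v).trans ?_
  simp

theorem sum_inner_infoOp_le (P : SCoinProtocol k ℓ s n) (u : Fin s → Bool)
    (b : OrthonormalBasis (Fin k) ℝ (EuclideanSpace ℝ (Fin k))) :
    ∑ j, inner ℝ (b j) (P.infoOp u (b j)) ≤ n * min (2 ^ ℓ : ℝ) k := by
  simp_rw [inner_infoOp]
  rw [Finset.sum_comm]
  have h : ∀ i, ∑ j, inner ℝ (b j) (channelOp (P.realChannel u i) (b j)) ≤
      min (2 ^ ℓ : ℝ) k := fun i => by
    refine le_min ?_ ?_
    · have := sum_inner_channelOp_le_card_output (P.realChannel_nonneg u i)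
        (P.sum_realChannel u i) b
      simpa using this
    · have := sum_inner_channelOp_le_card_input (P.realChannel_nonneg u i)
        (P.sum_realChannel u i) b
      simpa using this
  exact (Finset.sum_le_sum fun i _ => h i).trans (by simp)

open Classical in
/-- A uniformity test forces the decoupled chi-square fluctuation to be bounded below for some
seed, whatever the random perturbation of the uniform distribution. -/
theorem IsUniformityTest.exists_chaos_ge [NeZero k] {P : SCoinProtocol k ℓ s n} {ε : ℝ}
    (hP : P.IsUniformityTest ε) {Ω : Type*} [Fintype Ω] [Nonempty Ω]
    (z : Ω → EuclideanSpace ℝ (Fin k)) {γ : ℝ} (hγ0 : 0 ≤ γ) (hγ1 : γ ≤ 1)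
    (hz : ∀ ω x, -1 ≤ z ω x) (hz0 : ∀ ω, ∑ x, z ω x = 0)
    (hfar : 1 / 2 ≤ 𝔼 ω, if ε < γ / k * ∑ x, max (-z ω x) 0 then (1 : ℝ) else 0) :
    ∃ u, 1 + 9 / 64 ≤
      𝔼 ω, 𝔼 ω', Real.exp (γ ^ 2 / k * inner ℝ (z ω) (P.infoOp u (z ω'))) := by
  by_contra! hcon
  choose p hp hptv using fun ω => exists_perturbed_uniform hγ0 hγ1 (hz ω) (hz0 ω)
  have hunif : (P.outputProb (PMF.uniformOfFintype (Fin k)) true).toReal < 1 / 12 := by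
    have := P.toReal_outputProb_add (PMF.uniformOfFintype (Fin k))
    have := hP.1
    linarith
  have hreject : 11 / 24 ≤ 𝔼 ω, (P.outputProb (p ω) true).toReal := by
    have h1 : 11 / 12 * (𝔼 ω, if ε < γ / k * ∑ x, max (-z ω x) 0 then (1 : ℝ) else 0) ≤
        𝔼 ω, (P.outputProb (p ω) true).toReal := by
      rw [Finset.mul_expect]
      refine Finset.expect_le_expect fun ω _ => ?_
      split_ifs with hω
      · have := hP.2 (p ω) (hω.trans_le (hptv ω))
        linarith
      · rw [mul_zero]; exact ENNReal.toReal_nonneg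
    linarith
  -- Here 3/8 = 11/24 − 1/12, and 9/64 is its square.
  have hmix : 𝔼 ω, (P.outputProb (p ω) true).toReal ≤
      (P.outputProb (PMF.uniformOfFintype (Fin k)) true).toReal + 3 / 8 := by
    simp_rw [P.toReal_outputProb]
    rw [Finset.expect_comm, ← Fintype.expect_const (ι := Fin s → Bool) (3 / 8 : ℝ),
      ← Finset.expect_add_distrib]
    refine Finset.expect_le_expect fun u _ => ?_
    have h1 := expect_acceptance_le (P.realChannel u) (P.realChannel_nonneg u)
      (P.sum_realChannel u) (fun ω x => z ω x) γ hγ0 hγ1 hz hz0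
      (fun y => (P.server u y true).toReal) (fun y => ENNReal.toReal_nonneg)
      (fun y => by
        have := (P.server u y).sum_toReal
        rw [Fintype.sum_bool] at this
        have : 0 ≤ (P.server u y false).toReal := ENNReal.toReal_nonneg
        linarith)
    have h2 : ∀ ω, (fun x => (1 + γ * z ω x) / (Fintype.card (Fin k) : ℝ)) =
        fun x => (p ω x).toReal := fun ω => by
      funext x; rw [hp, Fintype.card_fin]
    have h3 : (fun _ : Fin k => 1 / (Fintype.card (Fin k) : ℝ)) =
        fun x => (PMF.uniformOfFintype (Fin k) x).toReal := by
      funext x; simp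
    have h4 : √((𝔼 ω, 𝔼 ω', Real.exp (γ ^ 2 / (Fintype.card (Fin k) : ℝ) * ∑ i, ∑ y,
          (∑ x, z ω x * P.realChannel u i x y) * (∑ x, z ω' x * P.realChannel u i x y) /
            ∑ x, P.realChannel u i x y)) - 1) ≤ 3 / 8 := by
      apply Real.sqrt_le_iff.2 ⟨by norm_num, ?_⟩
      have h5 := hcon u
      simp_rw [inner_infoOp, inner_channelOp] at h5
      rw [Fintype.card_fin]
      norm_num at h5 ⊢
      linarith
    simp_rw [h2, h3] at h1
    linarith
  linarith

end SCoinProtocol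

/-! ### Lower bounds for large and small domains -/

namespace SCoinProtocol

variable {k ℓ s n : ℕ}

/-- The lower bound on the number of users for large domains, in squared form. -/
theorem IsUniformityTest.le_sq_of_large [NeZero k] {P : SCoinProtocol k ℓ s n} {ε : ℝ}
    (hP : P.IsUniformityTest ε) (hε : 0 < ε) {θ : ℝ} (hθ : 0 < θ) (hθ10 : θ ≤ 1 / 10)
    (hεθ : ε ≤ 1 - 5 * θ) (hk : 1 ≤ θ * k) {t : ℕ} (ht : 2 / θ ^ 3 ≤ t) :
    θ * (k * max ((k : ℝ) / 2 ^ ℓ) 1 * max ((k : ℝ) / 2 ^ (s + ℓ)) 1) ≤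
      128 * t ^ 2 * (n ^ 2 * ε ^ 4) := by
  classical
  have hk0 : (0 : ℝ) < k := by exact_mod_cast Nat.pos_of_ne_zero (NeZero.ne k)
  have ht0 : (0 : ℝ) < t := lt_of_lt_of_le (by positivity) ht
  set T : ℝ := min (2 ^ ℓ : ℝ) k with hT
  have hT0 : 0 < T := lt_min (by positivity) hk0
  obtain ⟨b, L, hL, hAL⟩ := exists_low_spectral_subspace P.infoOp P.infoOp_isSymmetric
    P.inner_infoOp_self_nonneg (N := n) (T := T) (κ := θ) (Nat.cast_nonneg n) hT0.le hθ
    (Nat.pos_of_ne_zero (NeZero.ne k)) P.inner_infoOp_self_le P.sum_inner_infoOp_le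
  obtain ⟨Ω, _, _, z, hz, hz0, hsub, hbig⟩ := exists_subgaussian_perturbation b L hθ
    (by linarith) (by simpa using hL) (by simpa using hk) ht
  have h5 : 1 / 2 ≤ 1 - 5 * θ := by linarith
  have h50 : 0 < 1 - 5 * θ := by linarith
  -- Since (1 − θ)(1 − 4θ) > 1 − 5θ, this γ puts the good perturbations strictly beyond distance ε.
  set γ : ℝ := ε / (1 - 5 * θ) with hγ
  have hγ0 : 0 < γ := div_pos hε h50
  have hγ1 : γ ≤ 1 := (div_le_one h50).2 hεθ
  have hγε : γ * (1 - 5 * θ) = ε := by rw [hγ]; field_simp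
  have hγ2 : γ ≤ 2 * ε := by nlinarith
  obtain ⟨u, hu⟩ := hP.exists_chaos_ge z hγ0.le hγ1 hz hz0 (by
    refine hbig.trans (Finset.expect_le_expect fun ω _ => ?_)
    by_cases hω : (1 - θ) * ((1 - 4 * θ) * (Fintype.card (Fin k) : ℝ)) ≤ ∑ x, max (-z ω x) 0
    · rw [if_pos hω, if_pos]
      rw [Fintype.card_fin] at hω
      calc ε < γ / k * ((1 - θ) * ((1 - 4 * θ) * k)) := by
            have : γ / k * ((1 - θ) * ((1 - 4 * θ) * k)) = ε + γ * (4 * θ ^ 2) := by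
              rw [← hγε]; field_simp; ring
            rw [this]
            have : 0 < γ * (4 * θ ^ 2) := by positivity
            linarith
        _ ≤ _ := by gcongr
    · rw [if_neg hω]; split_ifs <;> norm_num)
  set τ : ℝ := γ ^ 2 / k with hτ
  have hτ0 : 0 < τ := by positivity
  set R : ℝ := n ^ 2 * T * min 1 (Fintype.card (Fin s → Bool) * T / (θ * k)) with hR
  -- Otherwise the chaos bound gives 1 + 1/8 < 1 + 9/64 for every seed.
  have hR8 : 1 / 8 ≤ t ^ 2 * τ ^ 2 * R := by
    by_contra! hcon
    set S : ℝ := 1 / 8 / (t ^ 2 * τ ^ 2) with hS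
    have htτ : (0 : ℝ) < t ^ 2 * τ ^ 2 := by positivity
    have hRS : R < S := by rw [hS, lt_div_iff₀ htτ]; linarith
    have hS8 : t ^ 2 * τ ^ 2 * S = 1 / 8 := by rw [hS]; field_simp
    have := expect_exp_chaos_le z (fun l : L => b l) t ht0.le
      (fun v => by
        rw [Finset.sum_coe_sort L fun l => inner ℝ (b l) v ^ 2]
        exact hsub v)
      (P.infoOp u) (P.infoOp_isSymmetric u) τ S ((hAL u).trans_lt hRS) (by rw [hS8]; norm_num)
    rw [hS8] at this
    linarith
  set α : ℝ := max ((k : ℝ) / 2 ^ ℓ) 1 with hα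
  set β : ℝ := max ((k : ℝ) / 2 ^ (s + ℓ)) 1 with hβ
  have hα1 : 1 ≤ α := le_max_right _ _
  have hβ1 : 1 ≤ β := le_max_right _ _
  have hTα : T * α ≤ k := by
    rw [hα, mul_max_of_nonneg _ _ hT0.le, mul_one]
    refine max_le ?_ (min_le_right _ _)
    rw [mul_div_assoc', div_le_iff₀ (by positivity), mul_comm]
    gcongr
    exact min_le_left _ _
  have hmβ : min 1 (Fintype.card (Fin s → Bool) * T / (θ * k)) * (θ * β) ≤ 1 := by
    have hm0 : 0 ≤ min 1 (Fintype.card (Fin s → Bool) * T / (θ * k)) := by positivity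
    rcases le_total ((k : ℝ) / 2 ^ (s + ℓ)) 1 with h | h
    · rw [hβ, max_eq_right h, mul_one]
      exact mul_le_one₀ (min_le_left _ _) hθ.le (by linarith)
    · rw [hβ, max_eq_left h]
      refine (mul_le_mul_of_nonneg_right (min_le_right _ _) (by positivity)).trans ?_
      have : (Fintype.card (Fin s → Bool) : ℝ) * T / (θ * k) * (θ * (k / 2 ^ (s + ℓ))) =
          T / 2 ^ ℓ := by
        simp only [Fintype.card_fun, Fintype.card_bool, Fintype.card_fin, Nat.cast_pow,
          Nat.cast_ofNat, pow_add]
        field_simp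
      rw [this, div_le_one (by positivity)]
      exact min_le_left _ _
  have hRk : R * (θ * (α * β)) ≤ n ^ 2 * k := by
    calc R * (θ * (α * β)) = n ^ 2 * (T * α) *
          (min 1 (Fintype.card (Fin s → Bool) * T / (θ * k)) * (θ * β)) := by rw [hR]; ring
      _ ≤ n ^ 2 * k * 1 := by gcongr
      _ = _ := by ring
  have hγ4 : γ ^ 4 ≤ 16 * ε ^ 4 := by
    calc γ ^ 4 ≤ (2 * ε) ^ 4 := by gcongr
      _ = _ := by ring
  calc θ * (k * α * β) = 8 * k * (θ * (α * β)) * (1 / 8) := by ring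
    _ ≤ 8 * k * (θ * (α * β)) * (t ^ 2 * τ ^ 2 * R) := by gcongr
    _ = 8 * k * t ^ 2 * τ ^ 2 * (R * (θ * (α * β))) := by ring
    _ ≤ 8 * k * t ^ 2 * τ ^ 2 * (n ^ 2 * k) := by gcongr
    _ = 8 * t ^ 2 * n ^ 2 * γ ^ 4 := by rw [hτ]; field_simp
    _ ≤ 8 * t ^ 2 * n ^ 2 * (16 * ε ^ 4) := by gcongr
    _ = _ := by ring

/-- A lower bound on the number of users from a single alternative; it is sharp only on domains
of bounded size. -/
theorem IsUniformityTest.one_le_of_two_le [NeZero k] {P : SCoinProtocol k ℓ s n} {ε : ℝ}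
    (hP : P.IsUniformityTest ε) (hε : 0 < ε) (hk : 2 ≤ k) (hεk : ε < 1 - 1 / (k : ℝ)) :
    1 ≤ 144 * k * (n * ε ^ 2) := by
  classical
  have hk2 : (2 : ℝ) ≤ k := by exact_mod_cast hk
  have hk0 : (0 : ℝ) < k := by linarith
  -- At γ = 1 the alternative is the point mass at 0, at distance 1 − 1/k from uniform.
  set v : EuclideanSpace ℝ (Fin k) := WithLp.toLp 2 fun x => if x = 0 then (k : ℝ) - 1 else -1
    with hv
  have hvx : ∀ x, v x = if x = 0 then (k : ℝ) - 1 else -1 := fun x => rfl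
  have hsum : ∀ a c : ℝ, ∑ x : Fin k, (if x = 0 then a else c) = a + (k - 1) * c := by
    intro a c
    have : ∀ x : Fin k, (if x = 0 then a else c) = (if x = 0 then a - c else 0) + c := fun x => by
      split_ifs <;> ring
    simp_rw [this]
    rw [Finset.sum_add_distrib, Finset.sum_ite_eq' Finset.univ (0 : Fin k)]
    simp; ring
  -- The distance γ(1 − 1/k) exceeds ε: by `hεk` if γ = 1, and because 1 − 1/k ≥ 1/2 if γ = 4ε.
  set γ : ℝ := min 1 (4 * ε) with hγ
  have hγ0 : 0 < γ := lt_min one_pos (by linarith)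
  have hneg : ∑ x, max (-v x) 0 = k - 1 := by
    have : ∀ x, max (-v x) 0 = if x = 0 then (0 : ℝ) else 1 := fun x => by
      rw [hvx]; split_ifs
      · exact max_eq_right (by linarith)
      · norm_num
    simp_rw [this]; rw [hsum]; ring
  have hinv : 1 / (k : ℝ) ≤ 1 / 2 := one_div_le_one_div_of_le (by norm_num) hk2
  obtain ⟨u, hu⟩ := hP.exists_chaos_ge (Ω := Unit) (fun _ => v) hγ0.le (min_le_left _ _)
    (fun _ x => by rw [hvx]; split_ifs <;> linarith)
    (fun _ => by simp_rw [hvx]; rw [hsum]; ring)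
    (by
      have h1 : ε < γ / k * ∑ x, max (-v x) 0 := by
        have : γ / k * ((k : ℝ) - 1) = γ * (1 - 1 / k) := by field_simp
        rw [hneg, this]
        rcases min_choice (1 : ℝ) (4 * ε) with h | h
        · rw [hγ, h, one_mul]; exact hεk
        · rw [hγ, h]; nlinarith
      simp only [h1, if_true]
      rw [Fintype.expect_const]; norm_num)
  rw [Fintype.expect_const, Fintype.expect_const] at hu
  have hnorm : ‖v‖ ^ 2 ≤ k ^ 2 := by
    rw [EuclideanSpace.norm_sq_eq]
    have : ∀ x, ‖v x‖ ^ 2 = if x = 0 then ((k : ℝ) - 1) ^ 2 else 1 := fun x => by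
      rw [hvx, Real.norm_eq_abs, sq_abs]; split_ifs <;> norm_num
    simp_rw [this]; rw [hsum]; nlinarith
  have hx : γ ^ 2 / k * inner ℝ v (P.infoOp u v) ≤ 16 * k * (n * ε ^ 2) := by
    calc γ ^ 2 / k * inner ℝ v (P.infoOp u v) ≤ γ ^ 2 / k * (n * k ^ 2) := by
          gcongr
          exact (P.inner_infoOp_self_le u v).trans (by gcongr)
      _ = γ ^ 2 * (n * k) := by field_simp
      _ ≤ (4 * ε) ^ 2 * (n * k) := by gcongr; exact min_le_right _ _
      _ = _ := by ring
  by_contra! hcon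
  set x : ℝ := γ ^ 2 / k * inner ℝ v (P.infoOp u v) with hxdef
  -- Then exp x ≤ 1/(1 − x) ≤ 9/8 < 1 + 9/64; the constant 144 is 16 · 9.
  have hx9 : x ≤ 1 / 9 := by linarith
  have h1 := Real.add_one_le_exp (-x)
  rw [Real.exp_neg] at h1
  have h2 : Real.exp x * (-x + 1) ≤ 1 := by
    have := mul_le_mul_of_nonneg_left h1 (Real.exp_pos x).le
    rwa [mul_inv_cancel₀ (Real.exp_pos x).ne'] at this
  nlinarith [Real.exp_pos x]

end SCoinProtocol

/-! ### The final bound -/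

theorem mul_sqrt_le_of_sq_le {c ε k a b n : ℝ} (hε : 0 < ε) (hk : 0 ≤ k)
    (ha : 0 ≤ a) (hb : 0 ≤ b) (hn : 0 ≤ n) (h : c ^ 2 * (k * a * b) ≤ n ^ 2 * ε ^ 4) :
    c * (√k / ε ^ 2 * √a * √b) ≤ n := by
  have h1 : (c * (√k * √a * √b)) ^ 2 ≤ (n * ε ^ 2) ^ 2 := by
    simp only [mul_pow, Real.sq_sqrt hk, Real.sq_sqrt ha, Real.sq_sqrt hb]
    linarith
  have h2 := le_of_sq_le_sq h1 (by positivity)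
  have h3 : c * (√k / ε ^ 2 * √a * √b) = c * (√k * √a * √b) / ε ^ 2 := by ring
  rw [h3, div_le_iff₀ (by positivity)]
  exact h2

theorem theoremc (ε₀ : ℝ) (hε₀ : ε₀ < 1) :
    ∃ c : ℝ, 0 < c ∧
      ∀ (k ℓ s n : ℕ) [NeZero k] (ε : ℝ), 0 < ε → ε ≤ ε₀ → ε < 1 - 1 / (k : ℝ) →
        ∀ P : SCoinProtocol k ℓ s n, P.IsUniformityTest ε →
          c * (√(k : ℝ) / ε ^ 2 * √(max ((k : ℝ) / 2 ^ ℓ) 1) *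
            √(max ((k : ℝ) / 2 ^ (s + ℓ)) 1)) ≤ (n : ℝ) := by
  rcases le_or_gt ε₀ 0 with h0 | h0
  · exact ⟨1, one_pos, fun k ℓ s n _ ε hε hεε₀ => absurd (hε.trans_le hεε₀) h0.not_gt⟩
  set θ : ℝ := (1 - ε₀) / 10 with hθdef
  have hθ : 0 < θ := by rw [hθdef]; linarith
  have hθ10 : θ ≤ 1 / 10 := by rw [hθdef]; linarith
  obtain ⟨t, ht⟩ := exists_nat_ge (2 / θ ^ 3)
  have ht0 : (0 : ℝ) < t := lt_of_lt_of_le (by positivity) ht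
  -- The first term serves k ≥ 1/θ, where 128 ≤ 12². The second serves k < 1/θ, where both maxima
  -- are at most k and powers of k are absorbed by θ.
  set c : ℝ := min (θ / (12 * t)) (θ ^ 3 / 144) with hc
  have hc0 : 0 < c := lt_min (by positivity) (by positivity)
  refine ⟨c, hc0, fun k ℓ s n _ ε hε hεε₀ hεk P hP => ?_⟩
  have hk1 : 1 ≤ k := Nat.one_le_iff_ne_zero.2 (NeZero.ne k)
  have hk1' : (1 : ℝ) ≤ k := by exact_mod_cast hk1
  have hk0 : (0 : ℝ) < k := by linarith
  refine mul_sqrt_le_of_sq_le hε hk0.le (by positivity) (by positivity)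
    (Nat.cast_nonneg n) ?_
  set α : ℝ := max ((k : ℝ) / 2 ^ ℓ) 1 with hα
  set β : ℝ := max ((k : ℝ) / 2 ^ (s + ℓ)) 1 with hβ
  have hα1 : 1 ≤ α := le_max_right _ _
  have hβ1 : 1 ≤ β := le_max_right _ _
  rcases le_or_gt 1 (θ * k) with hk | hk
  · have h1 := hP.le_sq_of_large hε hθ hθ10 (by rw [hθdef]; linarith) hk ht
    have h2 : c ^ 2 ≤ (θ / (12 * t)) ^ 2 := pow_le_pow_left₀ hc0.le (min_le_left _ _) 2
    calc c ^ 2 * (k * α * β) ≤ (θ / (12 * t)) ^ 2 * (k * α * β) := by gcongr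
      _ = θ / (144 * t ^ 2) * (θ * (k * α * β)) := by field_simp; ring
      _ ≤ θ / (144 * t ^ 2) * (128 * t ^ 2 * (n ^ 2 * ε ^ 4)) := by gcongr
      _ = θ * (128 / 144) * (n ^ 2 * ε ^ 4) := by field_simp
      _ ≤ 1 * (n ^ 2 * ε ^ 4) := by gcongr; linarith
      _ = _ := one_mul _
  · have hk2 : 2 ≤ k := by
      by_contra hcon
      have : k = 1 := by omega
      subst this
      norm_num at hεk
      linarith
    have h1 := hP.one_le_of_two_le hε hk2 hεk
    have hαk : α ≤ k := max_le (div_le_self hk0.le (one_le_pow₀ one_le_two)) hk1'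
    have hβk : β ≤ k := max_le (div_le_self hk0.le (one_le_pow₀ one_le_two)) hk1'
    have h2 : c ^ 2 ≤ (θ ^ 3 / 144) ^ 2 := pow_le_pow_left₀ hc0.le (min_le_right _ _) 2
    have h3 : 1 ≤ (144 * k * (n * ε ^ 2)) ^ 2 := one_le_pow₀ h1
    calc c ^ 2 * (k * α * β) ≤ (θ ^ 3 / 144) ^ 2 * (k * k * k) := by gcongr
      _ = (θ ^ 3 / 144) ^ 2 * (k * k * k) * 1 := by ring
      _ ≤ (θ ^ 3 / 144) ^ 2 * (k * k * k) * (144 * k * (n * ε ^ 2)) ^ 2 := by gcongr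
      _ = (θ * k) ^ 5 * θ * (n ^ 2 * ε ^ 4) := by ring
      _ ≤ 1 ^ 5 * 1 * (n ^ 2 * ε ^ 4) := by gcongr; linarith
      _ = _ := by ring
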